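/- Let $(X_1,X_2)$ be a random vector with values in $\mathbb{E}_2=[0,\infty)^2\setminus\{0\}$ such that, for some $\alpha>0$, $\lim_{x\to\infty}x^{\alpha}P(X_v>x)=s_v\in(0,\infty)$ for $v=1,2$, and which is multivariate regularly varying: as $t\to\infty$, $tP(t^{-1/\alpha}(X_1,X_2)\in\cdot)$ converges vaguely to an infinite measure $\Lambda$ on $\mathbb{E}_2$ that is finite on Borel sets separated from the origin (vague convergence is tested on bounded continuous functions with support separated from the origin). Put $R=X_1+X_2$ and $W=X_1/R$, let $S$ be the angular probability measure of $\Lambda$ on $[0,1]$, $S(B)=\Lambda(y_1/(y_1+y_2)\in B,\ y_1+y_2>1)/\Lambda(y_1+y_2>1)$, and let $[a,b]$ be the angular support interval, $a=\sup\{w\in[0,1]:S([0,w))=0\}$, $b=\inf\{w\in[0,1]:S((w,1])=0\}$. Assume the second-order condition $\mathcal{SO}(\rho)$ with $\rho>0$: for every Borel set $B\subset[0,1]\setminus[a,b]$ with $\overline{B}\cap[a,b]=\emptyset$, $P(W\in B\mid R>t)=O(P(R>t)^{\rho})$ as $t\to\infty$. Let $\Delta=\{(s,t)\in[0,1]^2:s\le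 t\}$, and let $d:[0,1]\times\Delta\to[0,1]$ be a measurable function, continuous in $w$ for each fixed $(s,t)$ and continuous in $(s,t)$ for each fixed $w$, with $d(w,s,t)>0$ if and only if $w\notin[s,t]$, and $d(w,s,t)\ge d(w,s',t')$ whenever $s'\le s$ and $t'\ge t$. Let $L:[1,\infty)\to(0,\infty)$ be continuous with $L(r)\le Cr^{\delta}$ for all $r\ge1$, for some constants $C>0$ and $\delta\in(0,\alpha)$. Fix $\lambda,\gamma\in(0,\infty)$. Let $(X_{i,1},X_{i,2})$, $i\ge1$, be i.i.d. copies of $(X_1,X_2)$. For each $n$ order the first $n$ of them as random vectors $(X_{(i),1},X_{(i),2})$, $i=1,\dots,n$, so that $R_{(1)}\ge\dots\ge R_{(n)}$, where $R_{(i)}=X_{(i),1}+X_{(i),2}$ (ties being broken in an arbitrary measurable way), and put $W_{(i)}=X_{(i),1}/R_{(i)}$. For $1\le k\le n$ and $(s,t)\in\Delta$ let $$D_k(s,t)=\frac1k\sum_{i=1}^k d(W_{(i)},s,t)\,L(R_{(i)}/R_{(k)}),\qquad g_n(s,t)=t-s+\lambda k^{\gamma}D_k(s,t),$$ and let $(\widehat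 a_n,\widehat b_n)$ be any measurable minimizer of $g_n$ over $\Delta$, where $k=k_n$. If $k_n\to\infty$ and $k_n=o(n^{\rho/(\gamma+\rho)})$ as $n\to\infty$, then $\widehat a_n\to a$ and $\widehat b_n\to b$ in probability as $n\to\infty$. -/

import Mathlib

open MeasureTheory ProbabilityTheory Filter Topology
open scoped BoundedContinuousFunction ENNReal

noncomputable section

namespace AngularSupport

/-- The punctured nonnegative quadrant `[0,∞)² \ {0}`. -/
def E2 : Set (ℝ × ℝ) := {x | 0 ≤ x.1 ∧ 0 ≤ x.2 ∧ x ≠ 0}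

/-- The radial part `R = x₁ + x₂`. -/
def radius (x : ℝ × ℝ) : ℝ := x.1 + x.2

/-- The angular part `W = x₁ / (x₁ + x₂)`. -/
def angle (x : ℝ × ℝ) : ℝ := x.1 / radius x

/-- Asymptotically Pareto marginals: `x ^ α * P(X_v > x) → s_v ∈ (0,∞)` for `v = 1, 2`. -/
def ParetoMarginals {Ω : Type*} [MeasurableSpace Ω] (P : Measure Ω) (X : Ω → ℝ × ℝ)
    (α : ℝ) : Prop :=
  (∃ s : ℝ, 0 < s ∧ Tendsto (fun x : ℝ => x ^ α * P.real {ω | x < (X ω).1}) atTop (𝓝 s)) ∧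
  (∃ s : ℝ, 0 < s ∧ Tendsto (fun x : ℝ => x ^ α * P.real {ω | x < (X ω).2}) atTop (𝓝 s))

/-- Multivariate regular variation of index `α` with exponent measure `Λ`, a measure on `E2`
(regarded as a measure on the plane giving no mass to the complement of `E2`): `Λ` is infinite,
finite on Borel sets separated from the origin, and `t P(t^{-1/α} X ∈ ·)` converges vaguely to
`Λ`, i.e. along every bounded continuous function whose support is separated from the origin.
(Every such function on `E2` is the restriction of one on the plane, by Tietze extension.) -/
structure IsMRV {Ω : Type*} [MeasurableSpace Ω] (P : Measure Ω) (X : Ω → ℝ × ℝ)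
    (α : ℝ) (Λ : Measure (ℝ × ℝ)) : Prop where
  concentrated : Λ E2ᶜ = 0
  infinite : Λ Set.univ = ⊤
  finite_away : ∀ B : Set (ℝ × ℝ), MeasurableSet B → (0 : ℝ × ℝ) ∉ closure B → Λ B < ⊤
  vague : ∀ f : (ℝ × ℝ) →ᵇ ℝ, (0 : ℝ × ℝ) ∉ tsupport f →
    Tendsto (fun t : ℝ => t * ∫ ω, f (t ^ (-(1 / α)) • X ω) ∂P) atTop (𝓝 (∫ y, f y ∂Λ))

/-- The angular (spectral) probability measure on `[0,1]` of an exponent measure with respect to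
the `ℓ¹` norm: `S(B) = Λ(y₁ / (y₁ + y₂) ∈ B ∣ y₁ + y₂ > 1)`, the angular factor in the polar
decomposition `Λ(dr, dw) = ν_α(dr) S(dw)`. -/
def angularMeasure (Λ : Measure (ℝ × ℝ)) : Measure ℝ :=
  (ProbabilityTheory.cond Λ {y | 1 < radius y}).map angle

/-- Left endpoint `a = sup {w ∈ [0,1] : S([0,w)) = 0}` of the angular support interval. -/
def leftEnd (S : Measure ℝ) : ℝ := sSup {w | w ∈ Set.Icc (0 : ℝ) 1 ∧ S (Set.Ico 0 w) = 0}

/-- Right endpoint `b = inf {w ∈ [0,1] : S((w,1]) = 0}` of the angular support interval. -/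
def rightEnd (S : Measure ℝ) : ℝ := sInf {w | w ∈ Set.Icc (0 : ℝ) 1 ∧ S (Set.Ioc w 1) = 0}

/-- The second-order condition `SO(ρ)` relative to the interval `[a,b]`:
`P(W ∈ B ∣ R > t) = O(P(R > t) ^ ρ)` as `t → ∞`, for every Borel `B ⊆ [0,1] \ [a,b]` whose closure
does not meet `[a,b]`. -/
def SecondOrder {Ω : Type*} [MeasurableSpace Ω] (P : Measure Ω) (X : Ω → ℝ × ℝ)
    (a b ρ : ℝ) : Prop :=
  ∀ B : Set ℝ, MeasurableSet B → B ⊆ Set.Icc 0 1 \ Set.Icc a b →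
    closure B ∩ Set.Icc a b = ∅ →
    (fun t : ℝ =>
        (ProbabilityTheory.cond P {ω | t < radius (X ω)}).real {ω | angle (X ω) ∈ B})
      =O[atTop] (fun t : ℝ => P.real {ω | t < radius (X ω)} ^ ρ)

/-- `Δ = {(s,t) ∈ [0,1]² : s ≤ t}`. -/
def Delta : Set (ℝ × ℝ) :=
  {p | p.1 ∈ Set.Icc (0 : ℝ) 1 ∧ p.2 ∈ Set.Icc (0 : ℝ) 1 ∧ p.1 ≤ p.2}

/-- The assumptions on the function `d : [0,1] × Δ → [0,1]` measuring the distance from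
`w` to `[s,t]`; only the values of `d` on `[0,1] × Δ` matter. -/
structure IsAngularDist (d : ℝ → ℝ × ℝ → ℝ) : Prop where
  measurable : Measurable
    (fun x : (Set.Icc (0 : ℝ) 1 ×ˢ Delta : Set (ℝ × (ℝ × ℝ))) => d x.1.1 x.1.2)
  mem_Icc : ∀ w ∈ Set.Icc (0 : ℝ) 1, ∀ p ∈ Delta, d w p ∈ Set.Icc (0 : ℝ) 1
  continuousOn_left : ∀ p ∈ Delta, ContinuousOn (fun w => d w p) (Set.Icc (0 : ℝ) 1)
  continuousOn_right : ∀ w ∈ Set.Icc (0 : ℝ) 1, ContinuousOn (d w) Delta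
  pos_iff : ∀ w ∈ Set.Icc (0 : ℝ) 1, ∀ p ∈ Delta, 0 < d w p ↔ w ∉ Set.Icc p.1 p.2
  mono : ∀ w ∈ Set.Icc (0 : ℝ) 1, ∀ p ∈ Delta, ∀ q ∈ Delta,
    q.1 ≤ p.1 → p.2 ≤ q.2 → d w q ≤ d w p

/-- `y` lists the sample `x` in nonincreasing order of the radius (ties broken arbitrarily). -/
def IsRadialOrdering {n : ℕ} (x y : Fin n → ℝ × ℝ) : Prop :=
  (∃ σ : Equiv.Perm (Fin n), ∀ i, y i = x (σ i)) ∧ Antitone (fun i => radius (y i))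

/-- `D_k(s,t) = k⁻¹ ∑_{i=1}^k d(W_(i), s, t) L(R_(i) / R_(k))` for a radially ordered sample `y`
of size `n`, where `1 ≤ k ≤ n`. -/
def tailDist (d : ℝ → ℝ × ℝ → ℝ) (L : ℝ → ℝ) {n k : ℕ} (hk : 1 ≤ k) (hkn : k ≤ n)
    (y : Fin n → ℝ × ℝ) (p : ℝ × ℝ) : ℝ :=
  (1 / (k : ℝ)) * ∑ i : Fin k, d (angle (y (Fin.castLE hkn i))) p *
    L (radius (y (Fin.castLE hkn i)) / radius (y ⟨k - 1, by omega⟩))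

/-- The objective function `g_n(s,t) = t - s + lam * k ^ γ * D_k(s,t)`. -/
def objective (d : ℝ → ℝ × ℝ → ℝ) (L : ℝ → ℝ) (lam γ : ℝ) {n k : ℕ} (hk : 1 ≤ k) (hkn : k ≤ n)
    (y : Fin n → ℝ × ℝ) (p : ℝ × ℝ) : ℝ :=
  p.2 - p.1 + lam * (k : ℝ) ^ γ * tailDist d L hk hkn y p

/-- `(ahat, bhat)` is a measurable minimizer over `Δ` of the objective function, computed from the
radially ordered random sample `Y`. -/
structure IsEstimator {Ω : Type*} [MeasurableSpace Ω] (d : ℝ → ℝ × ℝ → ℝ) (L : ℝ → ℝ)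
    (lam γ : ℝ) {n k : ℕ} (hk : 1 ≤ k) (hkn : k ≤ n) (Y : Ω → Fin n → ℝ × ℝ)
    (ahat bhat : Ω → ℝ) : Prop where
  measurable_left : Measurable ahat
  measurable_right : Measurable bhat
  mem : ∀ ω, (ahat ω, bhat ω) ∈ Delta
  isMinOn : ∀ ω, IsMinOn (objective d L lam γ hk hkn (Y ω)) Delta (ahat ω, bhat ω)

end AngularSupport

end

open MeasureTheory ProbabilityTheory Filter Topology
open scoped BoundedContinuousFunction ENNReal

noncomputable section

namespace AngularSupport

/-! The Pareto marginals make `P(R > x)` of exact order `x ^ (-α)`. By Chebyshev's inequality for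
binomial counts, `R_(k)` then lies, with probability tending to one, between two deterministic
thresholds of order `(n/k) ^ (1/α)` (`withHighProb_threshold_le`, `withHighProb_le_threshold`).
Replacing `R_(k)` by these turns the order statistics in `D_k` into sums over the whole i.i.d.
sample.

Upper bound on `D_k` (`withHighProb_tailDist_le`). For an interval slightly larger than `[a,b]`, the
second-order condition gives an observation with `R ≥ s` and angle outside it probability `O(s ^
(-α(1+ρ)))`. The expected bound for `D_k` has order `(n/k) ^ (-ρ)`, and the growth condition on `k`
says precisely that `k ^ γ (n/k) ^ (-ρ)` vanishes. Markov's inequality then makes the penalty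
negligible.

Lower bound on `D_k` (`withHighProb_le_tailDist`). An interval `[s,1]` with `s > a`, or `[0,s]` with
`s < b`, misses angles charged by `S`. A positive fraction of the top `k` points has such angles, so
`D_k` stays above a constant and the penalty diverges, whereas `(0,1)` has objective value `1`. As
`D_k` is monotone, the minimizer lies in no such interval (`withHighProb_not_subset`): `ahat ≤ a +
η` and `bhat ≥ b - η`.

Comparing the minimizer with the enlarged interval bounds the length `bhat - ahat` by `b - a + 3η`,
which together with these two one-sided bounds gives the two others. -/

/-! ### Events of probability tending to one -/

/-- The events `Q n` have probability tending to one. -/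
def WithHighProb {Ω : Type*} [MeasurableSpace Ω] (P : Measure Ω) (Q : ℕ → Ω → Prop) : Prop :=
  Tendsto (fun n => P {ω | ¬ Q n ω}) atTop (𝓝 0)

lemma WithHighProb.mono {Ω : Type*} [MeasurableSpace Ω] {P : Measure Ω} {Q Q' : ℕ → Ω → Prop}
    (h : WithHighProb P Q) (hQ : ∀ᶠ n in atTop, ∀ ω, Q n ω → Q' n ω) : WithHighProb P Q' := by
  refine tendsto_of_tendsto_of_tendsto_of_le_of_le' tendsto_const_nhds h
    (Eventually.of_forall fun _ => zero_le) ?_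
  filter_upwards [hQ] with n hn
  exact measure_mono fun ω hω hq => hω (hn ω hq)

lemma WithHighProb.and {Ω : Type*} [MeasurableSpace Ω] {P : Measure Ω} {Q Q' : ℕ → Ω → Prop}
    (h : WithHighProb P Q) (h' : WithHighProb P Q') :
    WithHighProb P (fun n ω => Q n ω ∧ Q' n ω) := by
  have h2 := Tendsto.add h h'
  rw [add_zero] at h2
  refine tendsto_of_tendsto_of_tendsto_of_le_of_le tendsto_const_nhds h2
    (fun _ => zero_le) fun n => ?_
  refine le_trans (measure_mono ?_) (measure_union_le _ _)
  intro ω hω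
  by_cases hq : Q n ω
  · exact Or.inr fun hq' => hω ⟨hq, hq'⟩
  · exact Or.inl hq

lemma WithHighProb.of_forall {Ω : Type*} [MeasurableSpace Ω] {P : Measure Ω}
    {Q : ℕ → Ω → Prop} (h : ∀ᶠ n in atTop, ∀ ω, Q n ω) : WithHighProb P Q := by
  refine tendsto_const_nhds.congr' ?_
  filter_upwards [h] with n hn
  simp [hn]

/-! ### Counts of observations in a set -/

/-- The number of `j < n` with `X j ω ∈ A`. -/
def count {Ω E : Type*} (X : ℕ → Ω → E) (n : ℕ) (A : Set E) (ω : Ω) : ℝ :=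
  ∑ j ∈ Finset.range n, A.indicator (fun _ => (1 : ℝ)) (X j ω)

section Count

variable {Ω E : Type*} [MeasurableSpace Ω] [MeasurableSpace E] {P : Measure Ω}
  {X : ℕ → Ω → E}

/-- Markov's inequality. A first moment suffices, so neither independence nor a second moment of the
weights is needed. -/
lemma withHighProb_sum_le (hX_meas : ∀ i, Measurable (X i))
    (hX_ident : ∀ i, IdentDistrib (X i) (X 0) P P) {H : ℕ → E → ℝ}
    (hH : ∀ n, Measurable (H n)) (hH0 : ∀ n x, 0 ≤ H n x) {e : ℕ → ℝ}
    (he : ∀ᶠ n in atTop, ∫⁻ ω, ENNReal.ofReal (H n (X 0 ω)) ∂P ≤ ENNReal.ofReal (e n))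
    (hlim : Tendsto (fun n : ℕ => n * e n) atTop (𝓝 0)) {η : ℝ} (hη : 0 < η) :
    WithHighProb P (fun n ω => ∑ j ∈ Finset.range n, H n (X j ω) ≤ η) := by
  have hlim' : Tendsto (fun n : ℕ => ENNReal.ofReal (n * e n) / ENNReal.ofReal η) atTop (𝓝 0) := by
    have h1 := ENNReal.tendsto_ofReal hlim
    rw [ENNReal.ofReal_zero] at h1
    have h2 := ENNReal.Tendsto.div_const h1 (b := ENNReal.ofReal η) (Or.inr (by simpa using hη))
    simpa using h2
  refine tendsto_of_tendsto_of_tendsto_of_le_of_le' tendsto_const_nhds hlim'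
    (Eventually.of_forall fun _ => zero_le) ?_
  filter_upwards [he] with n hn
  have hm : ∀ j, Measurable fun ω => ENNReal.ofReal (H n (X j ω)) := fun j =>
    ENNReal.measurable_ofReal.comp ((hH n).comp (hX_meas j))
  have hint : ∫⁻ ω, ∑ j ∈ Finset.range n, ENNReal.ofReal (H n (X j ω)) ∂P
      ≤ ENNReal.ofReal (n * e n) := by
    rw [lintegral_finsetSum _ fun j _ => hm j, ENNReal.ofReal_mul (Nat.cast_nonneg n),
      ENNReal.ofReal_natCast]
    refine (Finset.sum_le_sum (g := fun _ => ENNReal.ofReal (e n)) fun j _ => ?_).trans (by simp)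
    refine le_trans (le_of_eq ?_) hn
    exact ((hX_ident j).comp (ENNReal.measurable_ofReal.comp (hH n))).lintegral_eq
  refine le_trans ?_ (ENNReal.div_le_div_right hint _)
  refine le_trans (measure_mono ?_) (meas_ge_le_lintegral_div
    (Finset.measurable_fun_sum _ fun j _ => hm j).aemeasurable (by simpa using hη)
    ENNReal.ofReal_ne_top)
  intro ω hω
  simp only [Set.mem_ofPred_eq, not_le] at hω ⊢
  rw [← ENNReal.ofReal_sum_of_nonneg fun j _ => hH0 n _]
  exact ENNReal.ofReal_le_ofReal hω.le

variable [IsProbabilityMeasure P]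

/-- Chebyshev's inequality: the variance of an indicator is at most its mean, and variances add by
pairwise independence. -/
lemma measure_abs_count_sub_ge (hX_meas : ∀ i, Measurable (X i)) (hX_indep : iIndepFun X P)
    (hX_ident : ∀ i, IdentDistrib (X i) (X 0) P P) (n : ℕ) {A : Set E} (hA : MeasurableSet A)
    {s : ℝ} (hs : 0 < s) :
    P {ω | s ≤ |count X n A ω - n * P.real (X 0 ⁻¹' A)|}
      ≤ ENNReal.ofReal (n * P.real (X 0 ⁻¹' A) / s ^ 2) := by
  set g : E → ℝ := A.indicator (fun _ => (1 : ℝ)) with hg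
  have hgm : Measurable g := measurable_const.indicator hA
  set Z : ℕ → Ω → ℝ := fun j => g ∘ X j with hZ
  have hZi : ∀ j, Z j = (X j ⁻¹' A).indicator (fun _ => (1 : ℝ)) := by
    intro j; rfl
  have hZm : ∀ j, Measurable (Z j) := fun j => hgm.comp (hX_meas j)
  have hZ2 : ∀ j, MemLp (Z j) 2 P := by
    intro j
    rw [hZi]
    exact memLp_indicator_const 2 ((hX_meas j) hA) 1 (Or.inr (measure_ne_top _ _))
  have hreal : ∀ j, P.real (X j ⁻¹' A) = P.real (X 0 ⁻¹' A) := by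
    intro j
    simp only [measureReal_def, (hX_ident j).measure_mem_eq hA]
  have hZE : ∀ j, ∫ ω, Z j ω ∂P = P.real (X 0 ⁻¹' A) := by
    intro j
    rw [hZi, integral_indicator ((hX_meas j) hA)]
    simp [hreal]
  have hvar : ∀ j, Var[Z j; P] ≤ P.real (X 0 ⁻¹' A) := by
    intro j
    refine (variance_le_expectation_sq (hZm j).aestronglyMeasurable).trans (le_of_eq ?_)
    rw [← hZE j]
    congr 1
    ext ω
    rw [hZi]
    by_cases h : ω ∈ X j ⁻¹' A <;> simp [h]
  have hcount : count X n A = ∑ j ∈ Finset.range n, Z j := by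
    ext ω; simp [count, hZ, hg]
  have hmem : MemLp (count X n A) 2 P := by
    rw [hcount]; exact memLp_finsetSum' _ fun j _ => hZ2 j
  have hmean : ∫ ω, count X n A ω ∂P = n * P.real (X 0 ⁻¹' A) := by
    rw [hcount]
    simp only [Finset.sum_apply]
    rw [integral_finsetSum _ fun j _ => (hZ2 j).integrable (by norm_num)]
    simp [hZE]
  have hV : Var[count X n A; P] ≤ n * P.real (X 0 ⁻¹' A) := by
    rw [hcount, IndepFun.variance_sum (fun j _ => hZ2 j)]
    · exact (Finset.sum_le_sum fun j _ => hvar j).trans (by simp)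
    · intro i _ j _ hij
      exact (hX_indep.indepFun hij).comp hgm hgm
  have := meas_ge_le_variance_div_sq hmem hs
  rw [hmean] at this
  exact this.trans (ENNReal.ofReal_le_ofReal (by gcongr))

lemma tendsto_ofReal_const_div {κ : ℕ → ℝ} (hκ : Tendsto κ atTop atTop) (c : ℝ) :
    Tendsto (fun n => ENNReal.ofReal (c / κ n)) atTop (𝓝 0) := by
  rw [← ENNReal.ofReal_zero]
  exact ENNReal.tendsto_ofReal (hκ.const_div_atTop c)

lemma withHighProb_le_count (hX_meas : ∀ i, Measurable (X i)) (hX_indep : iIndepFun X P)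
    (hX_ident : ∀ i, IdentDistrib (X i) (X 0) P P) {κ : ℕ → ℝ} (hκ : Tendsto κ atTop atTop)
    {A : ℕ → Set E} (hA : ∀ n, MeasurableSet (A n))
    (h : ∀ᶠ n : ℕ in atTop, 2 * κ n ≤ n * P.real (X 0 ⁻¹' A n)) :
    WithHighProb P (fun n ω => κ n ≤ count X n (A n) ω) := by
  refine tendsto_of_tendsto_of_tendsto_of_le_of_le' tendsto_const_nhds
    (tendsto_ofReal_const_div hκ 2) (Eventually.of_forall fun _ => zero_le) ?_
  filter_upwards [h, hκ.eventually_gt_atTop 0] with n hn hpos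
  set q := n * P.real (X 0 ⁻¹' A n) with hq
  have hq0 : 0 < q := by linarith
  -- Falling below `κ n ≤ q / 2` is a deviation of at least half the mean, with probability at most
  -- `4 / q ≤ 2 / κ n`.
  refine le_trans (measure_mono ?_) ((measure_abs_count_sub_ge hX_meas hX_indep hX_ident n (hA n)
    (s := q / 2) (by positivity)).trans (ENNReal.ofReal_le_ofReal ?_))
  · intro ω hω
    simp only [Set.mem_ofPred_eq, not_le] at hω ⊢
    rw [← hq, abs_sub_comm]
    exact le_trans (by linarith) (le_abs_self _)
  · rw [← hq, div_le_div_iff₀ (by positivity) hpos]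
    nlinarith

lemma withHighProb_count_lt (hX_meas : ∀ i, Measurable (X i)) (hX_indep : iIndepFun X P)
    (hX_ident : ∀ i, IdentDistrib (X i) (X 0) P P) {κ : ℕ → ℝ} (hκ : Tendsto κ atTop atTop)
    {A : ℕ → Set E} (hA : ∀ n, MeasurableSet (A n))
    (h : ∀ᶠ n : ℕ in atTop, n * P.real (X 0 ⁻¹' A n) ≤ κ n / 2) :
    WithHighProb P (fun n ω => count X n (A n) ω < κ n) := by
  refine tendsto_of_tendsto_of_tendsto_of_le_of_le' tendsto_const_nhds
    (tendsto_ofReal_const_div hκ 2) (Eventually.of_forall fun _ => zero_le) ?_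
  filter_upwards [h, hκ.eventually_gt_atTop 0] with n hn hpos
  set q := n * P.real (X 0 ⁻¹' A n) with hq
  refine le_trans (measure_mono ?_) ((measure_abs_count_sub_ge hX_meas hX_indep hX_ident n (hA n)
    (s := κ n / 2) (by positivity)).trans (ENNReal.ofReal_le_ofReal ?_))
  · intro ω hω
    simp only [Set.mem_ofPred_eq, not_lt] at hω ⊢
    rw [← hq]
    exact le_trans (by linarith) (le_abs_self _)
  · rw [← hq, div_le_div_iff₀ (by positivity) hpos]
    nlinarith

end Count

/-! ### Deterministic facts on radially ordered samples -/

section Ordering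

variable {n k : ℕ} {x y : Fin n → ℝ × ℝ}

lemma IsRadialOrdering.sum_eq (h : IsRadialOrdering x y) (F : ℝ × ℝ → ℝ) :
    ∑ i, F (y i) = ∑ i, F (x i) := by
  obtain ⟨⟨σ, hσ⟩, -⟩ := h
  simp only [hσ]
  exact Equiv.sum_comp σ fun i => F (x i)

lemma sum_castLE_eq (hkn : k ≤ n) (F : Fin n → ℝ) :
    ∑ i : Fin k, F (Fin.castLE hkn i) = ∑ i : Fin n, if (i : ℕ) < k then F i else 0 := by
  rw [← Finset.sum_filter]
  refine Finset.sum_bij (fun i _ => Fin.castLE hkn i) ?_ ?_ ?_ ?_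
  · intro i _; simp
  · intro i _ j _ hij; exact Fin.castLE_injective hkn hij
  · intro i hi
    exact ⟨⟨i, by simpa using hi⟩, Finset.mem_univ _, rfl⟩
  · intro i _; rfl

/-- Beyond the first `k - 1` ordered points every radius is at most `R_(k) < t`. The zero-based
index `k - 1` is the `k`-th largest point. -/
lemma sum_indicator_lt_of_radius_lt (h : IsRadialOrdering x y) (hk : 1 ≤ k) (hkn : k ≤ n) {t : ℝ}
    (ht : radius (y ⟨k - 1, by omega⟩) < t) :
    ∑ i, {z | t ≤ radius z}.indicator (fun _ => (1 : ℝ)) (x i) < k := by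
  rw [← h.sum_eq]
  have h1 : ∀ i : Fin n, {z | t ≤ radius z}.indicator (fun _ => (1 : ℝ)) (y i)
      ≤ if (i : ℕ) < k - 1 then (1 : ℝ) else 0 := by
    intro i
    by_cases hi : (i : ℕ) < k - 1
    · simp only [hi, if_true]
      exact Set.indicator_le_self' (fun _ _ => zero_le_one) _
    · have : radius (y i) ≤ radius (y ⟨k - 1, by omega⟩) := h.2 (Fin.mk_le_of_le_val (by omega))
      rw [Set.indicator_of_notMem]
      · simp [hi]
      · simp only [Set.mem_ofPred_eq, not_le]; linarith
  refine (Finset.sum_le_sum fun i _ => h1 i).trans_lt ?_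
  rw [← sum_castLE_eq (by omega : k - 1 ≤ n) fun _ => (1 : ℝ)]
  simp only [Finset.sum_const, Finset.card_univ, Fintype.card_fin, nsmul_eq_mul, mul_one]
  exact_mod_cast (by omega : k - 1 < k)

lemma le_sum_indicator_of_lt_radius (h : IsRadialOrdering x y) (hk : 1 ≤ k) (hkn : k ≤ n) {t : ℝ}
    (ht : t < radius (y ⟨k - 1, by omega⟩)) :
    (k : ℝ) ≤ ∑ i, {z | t < radius z}.indicator (fun _ => (1 : ℝ)) (x i) := by
  rw [← h.sum_eq]
  have h1 : ∀ i : Fin n, (if (i : ℕ) < k then (1 : ℝ) else 0)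
      ≤ {z | t < radius z}.indicator (fun _ => (1 : ℝ)) (y i) := by
    intro i
    by_cases hi : (i : ℕ) < k
    · have : radius (y ⟨k - 1, by omega⟩) ≤ radius (y i) := h.2 (Fin.le_def.2 (by simp; omega))
      rw [Set.indicator_of_mem]
      · simp [hi]
      · simp only [Set.mem_ofPred_eq]; linarith
    · simp only [hi, if_false]
      exact Set.indicator_nonneg (fun _ _ => zero_le_one) _
  refine le_trans (le_of_eq ?_) (Finset.sum_le_sum fun i _ => h1 i)
  rw [← sum_castLE_eq hkn fun _ => (1 : ℝ)]
  simp

lemma angle_mem_Icc {z : ℝ × ℝ} (hz : z ∈ E2) : angle z ∈ Set.Icc (0 : ℝ) 1 := by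
  obtain ⟨h1, h2, -⟩ := hz
  refine ⟨div_nonneg h1 (add_nonneg h1 h2), div_le_one_of_le₀ ?_ (add_nonneg h1 h2)⟩
  simp only [radius]; linarith

lemma radius_pos {z : ℝ × ℝ} (hz : z ∈ E2) : 0 < radius z := by
  obtain ⟨h1, h2, h3⟩ := hz
  rcases (add_nonneg h1 h2).lt_or_eq with h | h
  · exact h
  · exact absurd (Prod.ext (by simp; linarith) (by simp; linarith)) h3

lemma IsRadialOrdering.mem_E2 (h : IsRadialOrdering x y) (hx : ∀ i, x i ∈ E2) (i : Fin n) :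
    y i ∈ E2 := by
  obtain ⟨⟨σ, hσ⟩, -⟩ := h
  rw [hσ]; exact hx _

lemma IsRadialOrdering.one_le_radius_div (h : IsRadialOrdering x y) (hx : ∀ i, x i ∈ E2) (hk : 1 ≤ k)
    (hkn : k ≤ n) (i : Fin k) :
    1 ≤ radius (y (Fin.castLE hkn i)) / radius (y ⟨k - 1, by omega⟩) := by
  rw [one_le_div (radius_pos (h.mem_E2 hx _))]
  exact h.2 (Fin.le_def.2 (by simp; omega))

/-- The weighted indicator of a large observation with angle outside `[p.1, p.2]`. -/
def exceedance (p : ℝ × ℝ) (δ t : ℝ) (z : ℝ × ℝ) : ℝ :=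
  {z | t ≤ radius z ∧ angle z ∉ Set.Icc p.1 p.2}.indicator (fun z => (radius z / t) ^ δ) z

lemma exceedance_nonneg (p : ℝ × ℝ) (δ : ℝ) {t : ℝ} (ht : 0 ≤ t) (z : ℝ × ℝ) :
    0 ≤ exceedance p δ t z :=
  Set.indicator_apply_nonneg fun hz => Real.rpow_nonneg (div_nonneg (ht.trans hz.1) ht) _

variable {d : ℝ → ℝ × ℝ → ℝ} {L : ℝ → ℝ} {p q : ℝ × ℝ}

/-- Lowering `R_(k)` to `t` increases `(R / R_(k)) ^ δ`, and enlarging the sum to the full sample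
adds nonnegative terms; the result no longer involves the ordering. Points with angle in `p`
contribute zero to `D_k`. -/
lemma tailDist_le (h : IsRadialOrdering x y) (hx : ∀ i, x i ∈ E2) (hk : 1 ≤ k) (hkn : k ≤ n)
    (hd : IsAngularDist d) (hp : p ∈ Delta) (hL_pos : ∀ r, 1 ≤ r → 0 < L r)
    {C δ : ℝ} (hC : 0 < C) (hδ : 0 < δ) (hL_le : ∀ r, 1 ≤ r → L r ≤ C * r ^ δ) {t : ℝ} (ht0 : 0 < t)
    (ht : t ≤ radius (y ⟨k - 1, by omega⟩)) :
    tailDist d L hk hkn y p ≤ 1 / (k : ℝ) * (C * ∑ i, exceedance p δ t (x i)) := by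
  unfold tailDist
  rw [← h.sum_eq (exceedance p δ t), Finset.mul_sum _ _ C]
  refine mul_le_mul_of_nonneg_left ?_ (by positivity)
  have h1 : ∀ i : Fin k, d (angle (y (Fin.castLE hkn i))) p *
      L (radius (y (Fin.castLE hkn i)) / radius (y ⟨k - 1, by omega⟩))
      ≤ C * exceedance p δ t (y (Fin.castLE hkn i)) := by
    intro i
    have hw := angle_mem_Icc (h.mem_E2 hx (Fin.castLE hkn i))
    have hr := h.one_le_radius_div hx hk hkn i
    have hRk := radius_pos (h.mem_E2 hx ⟨k - 1, by omega⟩)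
    have hd01 := hd.mem_Icc _ hw p hp
    by_cases hB : angle (y (Fin.castLE hkn i)) ∈ Set.Icc p.1 p.2
    · have : d (angle (y (Fin.castLE hkn i))) p = 0 :=
        le_antisymm (not_lt.1 fun h0 => (hd.pos_iff _ hw p hp).1 h0 hB) hd01.1
      rw [this, zero_mul]
      exact mul_nonneg hC.le (exceedance_nonneg _ _ ht0.le _)
    · have hRi : radius (y ⟨k - 1, by omega⟩) ≤ radius (y (Fin.castLE hkn i)) :=
        (one_le_div hRk).1 hr
      have hRi0 : 0 ≤ radius (y (Fin.castLE hkn i)) := hRk.le.trans hRi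
      rw [exceedance, Set.indicator_of_mem (Set.mem_ofPred.2 ⟨ht.trans hRi, hB⟩)]
      refine (mul_le_of_le_one_left (hL_pos _ hr).le hd01.2).trans ((hL_le _ hr).trans ?_)
      gcongr
  refine (Finset.sum_le_sum fun i _ => h1 i).trans ?_
  rw [sum_castLE_eq hkn fun i => C * exceedance p δ t (y i)]
  refine Finset.sum_le_sum fun i _ => ?_
  split_ifs
  · exact le_rfl
  · exact mul_nonneg hC.le (exceedance_nonneg _ _ ht0.le _)

/-- Points of `A` have radius above `T ≥ R_(k)`, hence are automatically among the top `k`, and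
`radius ≤ M * t ≤ M * R_(k)` keeps the argument of `L` in `[1, M]`. -/
lemma le_tailDist (h : IsRadialOrdering x y) (hx : ∀ i, x i ∈ E2) (hk : 1 ≤ k) (hkn : k ≤ n)
    (hd : IsAngularDist d) (hp : p ∈ Delta) (hL_pos : ∀ r, 1 ≤ r → 0 < L r)
    {A : Set (ℝ × ℝ)} {c₁ c₂ M t T : ℝ} (hc₂ : 0 ≤ c₂)
    (hdA : ∀ z ∈ E2, z ∈ A → c₁ ≤ d (angle z) p)
    (hAT : ∀ z ∈ A, T < radius z ∧ radius z ≤ M * t)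
    (hL : ∀ r ∈ Set.Icc 1 M, c₂ ≤ L r) (hM : 0 ≤ M)
    (ht : t ≤ radius (y ⟨k - 1, by omega⟩)) (hT : radius (y ⟨k - 1, by omega⟩) ≤ T) :
    c₁ * c₂ * (1 / (k : ℝ) * ∑ i, A.indicator (fun _ => (1 : ℝ)) (x i))
      ≤ tailDist d L hk hkn y p := by
  unfold tailDist
  rw [← h.sum_eq (A.indicator fun _ => (1 : ℝ)), mul_left_comm, Finset.mul_sum _ _ (c₁ * c₂)]
  refine mul_le_mul_of_nonneg_left ?_ (by positivity)
  have h1 : ∀ i : Fin k, c₁ * c₂ * A.indicator (fun _ => (1 : ℝ)) (y (Fin.castLE hkn i)) ≤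
      d (angle (y (Fin.castLE hkn i))) p *
      L (radius (y (Fin.castLE hkn i)) / radius (y ⟨k - 1, by omega⟩)) := by
    intro i
    have hE := h.mem_E2 hx (Fin.castLE hkn i)
    have hr := h.one_le_radius_div hx hk hkn i
    have hRk := radius_pos (h.mem_E2 hx ⟨k - 1, by omega⟩)
    have hd01 := hd.mem_Icc _ (angle_mem_Icc hE) p hp
    by_cases hA : y (Fin.castLE hkn i) ∈ A
    · rw [Set.indicator_of_mem hA, mul_one]
      refine mul_le_mul (hdA _ hE hA) (hL _ ⟨hr, ?_⟩) hc₂ hd01.1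
      rw [div_le_iff₀ hRk]
      exact (hAT _ hA).2.trans (mul_le_mul_of_nonneg_left ht hM)
    · rw [Set.indicator_of_notMem hA, mul_zero]
      exact mul_nonneg hd01.1 (hL_pos _ hr).le
  refine le_trans ?_ (Finset.sum_le_sum fun i _ => h1 i)
  rw [sum_castLE_eq hkn fun i => c₁ * c₂ * A.indicator (fun _ => (1 : ℝ)) (y i)]
  refine Finset.sum_le_sum fun i _ => ?_
  split_ifs with hi
  · exact le_rfl
  · have hR : radius (y i) ≤ radius (y ⟨k - 1, by omega⟩) := h.2 (Fin.mk_le_of_le_val (by omega))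
    rw [Set.indicator_of_notMem fun hA => absurd (hAT _ hA).1 (not_lt.2 (hR.trans hT)), mul_zero]

lemma tailDist_anti (h : IsRadialOrdering x y) (hx : ∀ i, x i ∈ E2) (hk : 1 ≤ k) (hkn : k ≤ n)
    (hd : IsAngularDist d) (hL_pos : ∀ r, 1 ≤ r → 0 < L r) (hp : p ∈ Delta) (hq : q ∈ Delta)
    (h1 : q.1 ≤ p.1) (h2 : p.2 ≤ q.2) :
    tailDist d L hk hkn y q ≤ tailDist d L hk hkn y p := by
  unfold tailDist
  refine mul_le_mul_of_nonneg_left (Finset.sum_le_sum fun i _ => ?_) (by positivity)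
  exact mul_le_mul_of_nonneg_right
    (hd.mono _ (angle_mem_Icc (h.mem_E2 hx _)) p hp q hq h1 h2)
    (hL_pos _ (h.one_le_radius_div hx hk hkn i)).le

lemma tailDist_nonneg (h : IsRadialOrdering x y) (hx : ∀ i, x i ∈ E2) (hk : 1 ≤ k) (hkn : k ≤ n)
    (hd : IsAngularDist d) (hL_pos : ∀ r, 1 ≤ r → 0 < L r) (hp : p ∈ Delta) :
    0 ≤ tailDist d L hk hkn y p := by
  refine mul_nonneg (by positivity) (Finset.sum_nonneg fun i _ => ?_)
  exact mul_nonneg (hd.mem_Icc _ (angle_mem_Icc (h.mem_E2 hx _)) p hp).1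
    (hL_pos _ (h.one_le_radius_div hx hk hkn i)).le

lemma tailDist_zero_one (h : IsRadialOrdering x y) (hx : ∀ i, x i ∈ E2) (hk : 1 ≤ k)
    (hkn : k ≤ n) (hd : IsAngularDist d) : tailDist d L hk hkn y (0, 1) = 0 := by
  unfold tailDist
  rw [Finset.sum_eq_zero, mul_zero]
  intro i _
  have hw := angle_mem_Icc (h.mem_E2 hx (Fin.castLE hkn i))
  have hp : ((0, 1) : ℝ × ℝ) ∈ Delta := by simp [Delta]
  have : d (angle (y (Fin.castLE hkn i))) (0, 1) = 0 :=
    le_antisymm (not_lt.1 fun h0 => (hd.pos_iff _ hw _ hp).1 h0 hw) (hd.mem_Icc _ hw _ hp).1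
  rw [this, zero_mul]

end Ordering

/-! ### Tail estimates -/

section Tails

variable {Ω : Type*} [MeasurableSpace Ω] {P : Measure Ω} [IsProbabilityMeasure P]

lemma continuous_radius : Continuous radius := by unfold radius; fun_prop

lemma measurable_angle : Measurable angle :=
  measurable_fst.div continuous_radius.measurable

/-- `X₁ ≤ R`, and `R > x` forces one coordinate above `x / 2`. Only the order of the tail matters
later, not a limit. -/
lemma exists_tail_bounds {Z : Ω → ℝ × ℝ} (hE : ∀ ω, Z ω ∈ E2) {α : ℝ}
    (hpareto : ParetoMarginals P Z α) :
    ∃ c > 0, ∃ c' > 0, ∀ᶠ x : ℝ in atTop, c ≤ x ^ α * P.real {ω | x < radius (Z ω)} ∧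
      x ^ α * P.real {ω | x < radius (Z ω)} ≤ c' := by
  obtain ⟨⟨s₁, hs₁, h₁⟩, s₂, hs₂, h₂⟩ := hpareto
  have hhalf : Tendsto (fun x : ℝ => x / 2) atTop atTop := tendsto_id.atTop_div_const two_pos
  refine ⟨s₁ / 2, by positivity, 2 ^ α * (2 * s₁ + 2 * s₂), by positivity, ?_⟩
  filter_upwards [h₁.eventually_const_lt (half_lt_self hs₁),
    (h₁.comp hhalf).eventually_lt_const (by linarith : s₁ < 2 * s₁),
    (h₂.comp hhalf).eventually_lt_const (by linarith : s₂ < 2 * s₂), eventually_gt_atTop 0]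
    with x hx h1 h2 hx0
  constructor
  · refine hx.le.trans (mul_le_mul_of_nonneg_left (measureReal_mono fun ω hω => ?_)
      (by positivity))
    have h0 := (hE ω).2.1
    simp only [Set.mem_ofPred_eq, radius] at hω ⊢
    linarith
  · have hsplit : P.real {ω | x < radius (Z ω)} ≤
        P.real {ω | x / 2 < (Z ω).1} + P.real {ω | x / 2 < (Z ω).2} := by
      refine (measureReal_mono fun ω hω => ?_).trans (measureReal_union_le _ _)
      simp only [Set.mem_ofPred_eq, radius, Set.mem_union] at hω ⊢
      by_contra! hcon
      linarith [hcon.1, hcon.2]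
    have hx2 : x ^ α = 2 ^ α * (x / 2) ^ α := by
      rw [← Real.mul_rpow (by norm_num) (by positivity)]; congr 1; ring
    simp only [Function.comp_apply] at h1 h2
    calc x ^ α * P.real {ω | x < radius (Z ω)}
        ≤ x ^ α * (P.real {ω | x / 2 < (Z ω).1} + P.real {ω | x / 2 < (Z ω).2}) := by gcongr
      _ = 2 ^ α * ((x / 2) ^ α * P.real {ω | x / 2 < (Z ω).1}
          + (x / 2) ^ α * P.real {ω | x / 2 < (Z ω).2}) := by rw [hx2]; ring
      _ ≤ _ := by gcongr

/-- Multiplying the conditional bound `K π ^ ρ` by `π = P(R > s/2)` gives the exponent `1 + ρ`.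
Passing to `s / 2` puts the closed event inside the strict one at the cost of a constant. -/
lemma tail_outside_le {Z : Ω → ℝ × ℝ} (hZ : Measurable Z) {α ρ c' : ℝ} (hρ : 0 < ρ)
    {B : Set ℝ} (hc' : 0 < c')
    (htail : ∀ᶠ x : ℝ in atTop, x ^ α * P.real {ω | x < radius (Z ω)} ≤ c')
    (hB : (fun t : ℝ => (ProbabilityTheory.cond P {ω | t < radius (Z ω)}).real
        {ω | angle (Z ω) ∈ B})
      =O[atTop] (fun t : ℝ => P.real {ω | t < radius (Z ω)} ^ ρ)) :
    ∃ K > 0, ∀ᶠ s : ℝ in atTop,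
      P.real {ω | s ≤ radius (Z ω) ∧ angle (Z ω) ∈ B} ≤ K * s ^ (-(α * (1 + ρ))) := by
  obtain ⟨K, hK, hKb⟩ := hB.exists_pos
  have hhalf : Tendsto (fun x : ℝ => x / 2) atTop atTop := tendsto_id.atTop_div_const two_pos
  refine ⟨K * c' ^ (1 + ρ) * 2 ^ (α * (1 + ρ)), by positivity, ?_⟩
  filter_upwards [hhalf.eventually hKb.bound, hhalf.eventually htail, eventually_gt_atTop 0]
    with s h1 h2 hs
  set π := P.real {ω | s / 2 < radius (Z ω)} with hπ
  have hπ0 : 0 ≤ π := measureReal_nonneg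
  have hmeas : MeasurableSet {ω | s / 2 < radius (Z ω)} :=
    measurableSet_lt measurable_const (continuous_radius.measurable.comp hZ)
  have hcond : P.real ({ω | s / 2 < radius (Z ω)} ∩ {ω | angle (Z ω) ∈ B}) =
      (ProbabilityTheory.cond P {ω | s / 2 < radius (Z ω)}).real {ω | angle (Z ω) ∈ B} * π := by
    simp only [hπ, measureReal_def, ← ENNReal.toReal_mul]
    rw [cond_mul_eq_inter hmeas]
  rw [Real.norm_of_nonneg measureReal_nonneg, Real.norm_of_nonneg (by positivity)] at h1
  have hs2 : 0 < (s / 2) ^ α := by positivity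
  calc P.real {ω | s ≤ radius (Z ω) ∧ angle (Z ω) ∈ B}
      ≤ P.real ({ω | s / 2 < radius (Z ω)} ∩ {ω | angle (Z ω) ∈ B}) :=
        measureReal_mono fun ω hω => ⟨lt_of_lt_of_le (by linarith) hω.1, hω.2⟩
    _ ≤ (K * π ^ ρ) * π := by rw [hcond]; gcongr
    _ = K * π ^ (1 + ρ) := by
        rw [Real.rpow_add_of_nonneg hπ0 zero_le_one hρ.le, Real.rpow_one]; ring
    _ ≤ K * (c' / (s / 2) ^ α) ^ (1 + ρ) := by
        gcongr
        rw [le_div_iff₀ hs2, mul_comm]; exact h2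
    _ = _ := by
        rw [Real.div_rpow hc'.le hs2.le, ← Real.rpow_mul (by positivity),
          Real.div_rpow hs.le (by norm_num), Real.rpow_neg hs.le]
        field_simp

lemma measurableSet_exceedance (p : ℝ × ℝ) (t : ℝ) :
    MeasurableSet {z : ℝ × ℝ | t ≤ radius z ∧ angle z ∉ Set.Icc p.1 p.2} :=
  (measurableSet_le measurable_const continuous_radius.measurable).inter
    (measurable_angle measurableSet_Icc).compl

lemma measurable_exceedance (p : ℝ × ℝ) (δ t : ℝ) : Measurable (exceedance p δ t) :=
  ((continuous_radius.measurable.div_const t).pow_const δ).indicator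
    (measurableSet_exceedance p t)

/-- Dyadic decomposition of the radius: on `2^j ≤ R/t < 2^(j+1)` the weight is at most `2^((j+1)δ)`
and the probability at most `K (2^j t)^(-β)`, leaving a geometric series of ratio `2^(δ-β) < 1`. -/
lemma lintegral_exceedance_le {Z : Ω → ℝ × ℝ} (hZ : Measurable Z) (p : ℝ × ℝ) {δ β K : ℝ}
    (hδ : 0 < δ) (hδβ : δ < β) (hK : 0 < K) {t : ℝ} (ht : 0 < t)
    (h : ∀ s, t ≤ s →
      P.real {ω | s ≤ radius (Z ω) ∧ angle (Z ω) ∉ Set.Icc p.1 p.2} ≤ K * s ^ (-β)) :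
    ∫⁻ ω, ENNReal.ofReal (exceedance p δ t (Z ω)) ∂P
      ≤ ENNReal.ofReal (K * 2 ^ δ * (1 - 2 ^ (δ - β))⁻¹ * t ^ (-β)) := by
  set r : ℝ := 2 ^ (δ - β) with hr
  have hr0 : 0 ≤ r := by positivity
  have hr1 : r < 1 := Real.rpow_lt_one_of_one_lt_of_neg one_lt_two (by linarith)
  set A : ℕ → Set Ω := fun j =>
    {ω | 2 ^ j * t ≤ radius (Z ω) ∧ angle (Z ω) ∉ Set.Icc p.1 p.2} with hA
  have hAm : ∀ j, MeasurableSet (A j) := fun j => hZ (measurableSet_exceedance p _)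
  have hpt : ∀ ω, ENNReal.ofReal (exceedance p δ t (Z ω)) ≤
      ∑' j : ℕ, (A j).indicator (fun _ => ENNReal.ofReal ((2 ^ (j + 1)) ^ δ)) ω := by
    intro ω
    by_cases hω : Z ω ∈ {z | t ≤ radius z ∧ angle z ∉ Set.Icc p.1 p.2}
    · obtain ⟨j, hj1, hj2⟩ := exists_nat_pow_near ((one_le_div ht).2 hω.1) (one_lt_two (α := ℝ))
      have hmem : ω ∈ A j := ⟨(le_div_iff₀ ht).1 hj1, hω.2⟩
      refine le_trans ?_ (ENNReal.le_tsum j)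
      rw [Set.indicator_of_mem hmem, exceedance, Set.indicator_of_mem hω]
      refine ENNReal.ofReal_le_ofReal (Real.rpow_le_rpow ?_ hj2.le hδ.le)
      exact le_trans (by positivity) hj1
    · rw [exceedance, Set.indicator_of_notMem hω]
      simp
  have hterm : ∀ j : ℕ, ENNReal.ofReal ((2 ^ (j + 1)) ^ δ) * P (A j) ≤
      ENNReal.ofReal (K * 2 ^ δ * t ^ (-β) * r ^ j) := by
    intro j
    rw [← ofReal_measureReal (measure_ne_top P (A j)), ← ENNReal.ofReal_mul (by positivity)]
    refine ENNReal.ofReal_le_ofReal ?_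
    have h2 : (1 : ℝ) ≤ 2 ^ j := one_le_pow₀ one_le_two
    refine (mul_le_mul_of_nonneg_left (h (2 ^ j * t) (by nlinarith))
      (by positivity)).trans (le_of_eq ?_)
    rw [Real.mul_rpow (by positivity) ht.le, pow_succ, Real.mul_rpow (by positivity) two_pos.le,
      hr, ← Real.rpow_natCast (2 ^ (δ - β)) j, ← Real.rpow_natCast 2 j,
      ← Real.rpow_mul two_pos.le, ← Real.rpow_mul two_pos.le, ← Real.rpow_mul two_pos.le]
    have : (2 : ℝ) ^ ((δ - β) * (j : ℝ)) = 2 ^ ((j : ℝ) * δ) * 2 ^ ((j : ℝ) * -β) := by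
      rw [← Real.rpow_add two_pos]; congr 1; ring
    rw [this]; ring
  calc ∫⁻ ω, ENNReal.ofReal (exceedance p δ t (Z ω)) ∂P
      ≤ ∫⁻ ω, ∑' j : ℕ, (A j).indicator (fun _ => ENNReal.ofReal ((2 ^ (j + 1)) ^ δ)) ω ∂P :=
        lintegral_mono hpt
    _ = ∑' j : ℕ, ENNReal.ofReal ((2 ^ (j + 1)) ^ δ) * P (A j) := by
        rw [lintegral_tsum fun j => (measurable_const.indicator (hAm j)).aemeasurable]
        congr 1; ext j
        rw [lintegral_indicator_const (hAm j)]
    _ ≤ ∑' j : ℕ, ENNReal.ofReal (K * 2 ^ δ * t ^ (-β) * r ^ j) := ENNReal.tsum_le_tsum hterm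
    _ = _ := by
        rw [← ENNReal.ofReal_tsum_of_nonneg (fun j => by positivity)
          ((summable_geometric_of_lt_one hr0 hr1).mul_left _), tsum_mul_left,
          tsum_geometric_of_lt_one hr0 hr1]
        congr 1; ring

end Tails

/-! ### Behaviour of the extremal subsample -/

/-- The radial threshold `(A m)^{1/α}`. -/
def threshold (α A m : ℝ) : ℝ := (A * m) ^ (1 / α)

lemma threshold_rpow {α A m : ℝ} (hα : 0 < α) (h : 0 ≤ A * m) : threshold α A m ^ α = A * m := by
  rw [threshold, ← Real.rpow_mul h, one_div_mul_cancel hα.ne', Real.rpow_one]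

lemma tendsto_threshold {α A : ℝ} (hα : 0 < α) (hA : 0 < A) {m : ℕ → ℝ}
    (hm : Tendsto m atTop atTop) : Tendsto (fun n => threshold α A (m n)) atTop atTop :=
  (tendsto_rpow_atTop (by positivity)).comp (hm.const_mul_atTop hA)

lemma count_eq_sum_fin {Ω E : Type*} (X : ℕ → Ω → E) (n : ℕ) (A : Set E) (ω : Ω) :
    count X n A ω = ∑ i : Fin n, A.indicator (fun _ => (1 : ℝ)) (X i ω) :=
  Finset.sum_range _

lemma pos_of_div_pos {n k : ℕ} (h : 0 < (n : ℝ) / k) : 0 < (n : ℝ) ∧ 0 < (k : ℝ) := by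
  rcases (Nat.cast_nonneg (α := ℝ) n).eq_or_lt with h0 | h0
  · simp [← h0] at h
  rcases (Nat.cast_nonneg (α := ℝ) k).eq_or_lt with h1 | h1
  · simp [← h1] at h
  exact ⟨h0, h1⟩

section Extremes

variable {Ω : Type*} [MeasurableSpace Ω] {P : Measure Ω} [IsProbabilityMeasure P]
  {X : ℕ → Ω → ℝ × ℝ} {α : ℝ} {k : ℕ → ℕ} {Y : (n : ℕ) → Ω → Fin n → ℝ × ℝ}

lemma withHighProb_threshold_le (hX_meas : ∀ i, Measurable (X i)) (hX_indep : iIndepFun X P)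
    (hX_ident : ∀ i, IdentDistrib (X i) (X 0) P P) (hα : 0 < α) {c : ℝ} (hc : 0 < c)
    (htail : ∀ᶠ x : ℝ in atTop, c ≤ x ^ α * P.real {ω | x < radius (X 0 ω)})
    (hk : Tendsto k atTop atTop) (hm : Tendsto (fun n : ℕ => (n : ℝ) / k n) atTop atTop)
    (hY : ∀ n ω, IsRadialOrdering (fun i : Fin n => X i ω) (Y n ω)) :
    WithHighProb P (fun n ω => ∀ (h1 : 1 ≤ k n) (h2 : k n ≤ n),
      threshold α (c / 2) (n / k n) ≤ radius (Y n ω ⟨k n - 1, by omega⟩)) := by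
  have hthr := tendsto_threshold hα (half_pos hc) hm
  refine (withHighProb_le_count hX_meas hX_indep hX_ident
    (tendsto_natCast_atTop_atTop.comp hk)
    (A := fun n => {z | threshold α (c / 2) (n / k n) ≤ radius z})
    -- The factor `c / 2` in the threshold makes the expected count at least `2 k`; in the reverse
    -- bound, `2 * c` makes it at most `k / 2`.
    (fun n => measurableSet_le measurable_const continuous_radius.measurable) ?_).mono ?_
  · filter_upwards [hthr.eventually htail, hm.eventually_gt_atTop 0] with n hn hmn
    obtain ⟨hn0, hk0⟩ := pos_of_div_pos hmn
    rw [threshold_rpow hα (by positivity)] at hn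
    have hle : P.real {ω | threshold α (c / 2) (n / k n) < radius (X 0 ω)} ≤
        P.real (X 0 ⁻¹' {z | threshold α (c / 2) (n / k n) ≤ radius z}) :=
      measureReal_mono fun ω hω => le_of_lt (by simpa using hω)
    have hn' := hn.trans (mul_le_mul_of_nonneg_left hle (by positivity))
    have e : c / 2 * (n / k n) * P.real (X 0 ⁻¹' {z | threshold α (c / 2) (n / k n) ≤ radius z})
      = c * (n * P.real (X 0 ⁻¹' {z | threshold α (c / 2) (n / k n) ≤ radius z}) / (2 * k n)) := by
      field_simp
    rw [e] at hn'
    have := (le_mul_iff_one_le_right hc).1 hn'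
    rwa [one_le_div (by positivity)] at this
  · refine Eventually.of_forall fun n ω h h1 h2 => ?_
    by_contra! hlt
    rw [count_eq_sum_fin] at h
    exact absurd (sum_indicator_lt_of_radius_lt (hY n ω) h1 h2 hlt) (not_lt.2 h)

lemma withHighProb_le_threshold (hX_meas : ∀ i, Measurable (X i)) (hX_indep : iIndepFun X P)
    (hX_ident : ∀ i, IdentDistrib (X i) (X 0) P P) (hα : 0 < α) {c : ℝ} (hc : 0 < c)
    (htail : ∀ᶠ x : ℝ in atTop, x ^ α * P.real {ω | x < radius (X 0 ω)} ≤ c)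
    (hk : Tendsto k atTop atTop) (hm : Tendsto (fun n : ℕ => (n : ℝ) / k n) atTop atTop)
    (hY : ∀ n ω, IsRadialOrdering (fun i : Fin n => X i ω) (Y n ω)) :
    WithHighProb P (fun n ω => ∀ (h1 : 1 ≤ k n) (h2 : k n ≤ n),
      radius (Y n ω ⟨k n - 1, by omega⟩) ≤ threshold α (2 * c) (n / k n)) := by
  have hthr := tendsto_threshold hα (by positivity : 0 < 2 * c) hm
  refine (withHighProb_count_lt hX_meas hX_indep hX_ident
    (tendsto_natCast_atTop_atTop.comp hk)
    (A := fun n => {z | threshold α (2 * c) (n / k n) < radius z})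
    (fun n => measurableSet_lt measurable_const continuous_radius.measurable) ?_).mono ?_
  · filter_upwards [hthr.eventually htail, hm.eventually_gt_atTop 0] with n hn hmn
    obtain ⟨hn0, hk0⟩ := pos_of_div_pos hmn
    rw [threshold_rpow hα (by positivity)] at hn
    simp only [Set.preimage_ofPred_eq, Function.comp_apply]
    set π := P.real {ω | threshold α (2 * c) (n / k n) < radius (X 0 ω)}
    have e : 2 * c * (n / k n) * π = c * (2 * (n * π) / k n) := by field_simp
    rw [e] at hn
    have := (mul_le_iff_le_one_right hc).1 hn
    rw [div_le_one hk0] at this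
    linarith
  · refine Eventually.of_forall fun n ω h h1 h2 => ?_
    by_contra! hlt
    rw [count_eq_sum_fin] at h
    exact absurd (le_sum_indicator_of_lt_radius (hY n ω) h1 h2 hlt) (not_le.2 h)

variable {d : ℝ → ℝ × ℝ → ℝ} {L : ℝ → ℝ} {p : ℝ × ℝ}

lemma withHighProb_tailDist_le (hX_meas : ∀ i, Measurable (X i))
    (hX_ident : ∀ i, IdentDistrib (X i) (X 0) P P) (hX_E2 : ∀ i ω, X i ω ∈ E2) (hα : 0 < α)
    {ρ c' : ℝ} (hρ : 0 < ρ) (hc' : 0 < c')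
    (htail : ∀ᶠ x : ℝ in atTop, x ^ α * P.real {ω | x < radius (X 0 ω)} ≤ c')
    (hB : (fun t : ℝ => (ProbabilityTheory.cond P {ω | t < radius (X 0 ω)}).real
        {ω | angle (X 0 ω) ∈ Set.Icc (0 : ℝ) 1 \ Set.Icc p.1 p.2})
      =O[atTop] (fun t : ℝ => P.real {ω | t < radius (X 0 ω)} ^ ρ))
    (hd : IsAngularDist d) (hp : p ∈ Delta) (hL_pos : ∀ r, 1 ≤ r → 0 < L r)
    {C δ : ℝ} (hC : 0 < C) (hδ : 0 < δ) (hδα : δ < α) (hL_le : ∀ r, 1 ≤ r → L r ≤ C * r ^ δ)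
    {lam γ : ℝ} (hlam : 0 < lam)
    (hm : Tendsto (fun n : ℕ => (n : ℝ) / k n) atTop atTop)
    (hkm : Tendsto (fun n : ℕ => (k n : ℝ) ^ γ * ((n : ℝ) / k n) ^ (-ρ)) atTop (𝓝 0))
    (hY : ∀ n ω, IsRadialOrdering (fun i : Fin n => X i ω) (Y n ω))
    {A : ℝ} (hA : 0 < A) {η : ℝ} (hη : 0 < η) :
    WithHighProb P (fun n ω => ∀ (h1 : 1 ≤ k n) (h2 : k n ≤ n),
      threshold α A (n / k n) ≤ radius (Y n ω ⟨k n - 1, by omega⟩) →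
      lam * (k n : ℝ) ^ γ * tailDist d L h1 h2 (Y n ω) p ≤ η) := by
  obtain ⟨K, hK, hKev⟩ := tail_outside_le (hX_meas 0) hρ hc' htail hB
  obtain ⟨s₀, hs₀⟩ := eventually_atTop.1 hKev
  have hset : ∀ s, {ω | s ≤ radius (X 0 ω) ∧ angle (X 0 ω) ∉ Set.Icc p.1 p.2} =
      {ω | s ≤ radius (X 0 ω) ∧ angle (X 0 ω) ∈ Set.Icc (0 : ℝ) 1 \ Set.Icc p.1 p.2} := by
    intro s; ext ω
    have := angle_mem_Icc (hX_E2 0 ω)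
    simp only [Set.mem_ofPred_eq, Set.mem_sdiff, this, true_and]
  set β := α * (1 + ρ) with hβ
  have hδβ : δ < β := by nlinarith
  set K' := K * 2 ^ δ * (1 - 2 ^ (δ - β))⁻¹ with hK'
  have hthr := tendsto_threshold hα hA hm
  have hm0 : ∀ n : ℕ, 0 ≤ (n : ℝ) / k n := fun n => by positivity
  have hthr0 : ∀ n : ℕ, 0 ≤ threshold α A (n / k n) := fun n => by unfold threshold; positivity
  refine (withHighProb_sum_le hX_meas hX_ident
    (H := fun n z => lam * (k n : ℝ) ^ γ * (1 / k n * C) *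
      exceedance p δ (threshold α A (n / k n)) z)
    (e := fun n => lam * (k n : ℝ) ^ γ * (1 / k n * C) *
      (K' * threshold α A (n / k n) ^ (-β)))
    (fun n => (measurable_exceedance _ _ _).const_mul _)
    (fun n z => mul_nonneg (by positivity) (exceedance_nonneg _ _ (hthr0 n) _)) ?_ ?_ hη).mono ?_
  · filter_upwards [hthr.eventually_ge_atTop s₀, hthr.eventually_gt_atTop 0] with n hn hn0
    have hcoef : 0 ≤ lam * (k n : ℝ) ^ γ * (1 / k n * C) := by positivity
    simp only [ENNReal.ofReal_mul hcoef]
    have hmeas : Measurable fun ω =>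
        ENNReal.ofReal (exceedance p δ (threshold α A (n / k n)) (X 0 ω)) :=
      ENNReal.measurable_ofReal.comp ((measurable_exceedance _ _ _).comp (hX_meas 0))
    rw [lintegral_const_mul _ hmeas]
    gcongr
    refine lintegral_exceedance_le (hX_meas 0) p hδ hδβ hK hn0 fun s hs => ?_
    rw [hset]
    exact hs₀ s (hn.trans hs)
  · have hlim := hkm.const_mul (lam * C * K' * A ^ (-(1 + ρ)))
    rw [mul_zero] at hlim
    refine hlim.congr' ?_
    filter_upwards [hm.eventually_gt_atTop 0] with n hmn
    obtain ⟨hn0, hk0⟩ := pos_of_div_pos hmn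
    -- The exponent `β = α (1 + ρ)` produces a factor `k / n`, cancelling the `n` summands over the
    -- normalisation `k` and leaving `(n/k) ^ (-ρ)`.
    have h1 : threshold α A (n / k n) ^ (-β) =
        A ^ (-(1 + ρ)) * ((n / k n : ℝ) ^ (-ρ) * (k n / n)) := by
      rw [hβ, ← mul_neg, Real.rpow_mul (hthr0 n), threshold_rpow hα (by positivity),
        Real.mul_rpow hA.le (hm0 n), neg_add, add_comm (-1 : ℝ), Real.rpow_add hmn,
        Real.rpow_neg_one, inv_div]
    rw [h1]
    field_simp
  · filter_upwards [hthr.eventually_gt_atTop 0] with n hn0 ω h h1 h2 hle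
    refine le_trans ?_ h
    refine (mul_le_mul_of_nonneg_left (tailDist_le (hY n ω) (fun i => hX_E2 i ω) h1 h2 hd hp
      hL_pos hC hδ hL_le hn0 hle) (by positivity)).trans (le_of_eq ?_)
    rw [Finset.sum_range, ← Finset.mul_sum]
    ring

end Extremes

/-! ### The exponent measure and the angular support interval -/

section Exponent

lemma radius_smul (c : ℝ) (z : ℝ × ℝ) : radius (c • z) = c * radius z := by
  simp [radius, mul_add]

lemma angle_smul {c : ℝ} (hc : c ≠ 0) (z : ℝ × ℝ) : angle (c • z) = angle z := by
  rw [angle, angle, radius_smul]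
  exact mul_div_mul_left _ _ hc

variable {Ω : Type*} [MeasurableSpace Ω] {P : Measure Ω}
  {α : ℝ} {Λ : Measure (ℝ × ℝ)}

lemma zero_notMem_closure {G : Set (ℝ × ℝ)} (hG : ∀ z ∈ G, 1 ≤ radius z) :
    (0 : ℝ × ℝ) ∉ closure G := by
  intro h
  have h1 : closure G ⊆ {z | 1 ≤ radius z} :=
    closure_minimal hG (isClosed_le continuous_const continuous_radius)
  have := h1 h
  simp [radius] at this
  linarith

lemma measurableSet_one_lt_radius : MeasurableSet {z : ℝ × ℝ | 1 < radius z} :=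
  measurableSet_lt measurable_const continuous_radius.measurable

lemma IsMRV.measure_one_lt_radius_ne_top {Z : Ω → ℝ × ℝ} (h : IsMRV P Z α Λ) :
    Λ {z | 1 < radius z} ≠ ⊤ :=
  (h.finite_away _ measurableSet_one_lt_radius (zero_notMem_closure fun _ hz => hz.le)).ne

variable [IsProbabilityMeasure P]

lemma integrable_boundedContinuous_smul {Z : Ω → ℝ × ℝ} (hZ : Measurable Z) (f : (ℝ × ℝ) →ᵇ ℝ)
    (c : ℝ) : Integrable (fun ω => f (c • Z ω)) P :=
  Integrable.of_bound (f.continuous.measurable.comp (hZ.const_smul c)).aestronglyMeasurable ‖f‖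
    (Eventually.of_forall fun ω => f.norm_coe_le_norm (c • Z ω))

lemma integral_smul_le_measureReal {Z : Ω → ℝ × ℝ} (hZ : Measurable Z) {f : (ℝ × ℝ) →ᵇ ℝ}
    {G : Set (ℝ × ℝ)} (hG : MeasurableSet G) (hf : ∀ z, f z ≤ G.indicator (fun _ => (1 : ℝ)) z)
    (c : ℝ) : ∫ ω, f (c • Z ω) ∂P ≤ P.real {ω | c • Z ω ∈ G} := by
  have hm : MeasurableSet {ω | c • Z ω ∈ G} := (hZ.const_smul c) hG
  rw [← integral_indicator_one hm]
  exact integral_mono (integrable_boundedContinuous_smul hZ f c)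
    ((integrable_const (1 : ℝ)).indicator hm) fun ω => hf (c • Z ω)

lemma measureReal_le_integral_smul {Z : Ω → ℝ × ℝ} (hZ : Measurable Z) {f : (ℝ × ℝ) →ᵇ ℝ}
    {G : Set (ℝ × ℝ)} (hG : MeasurableSet G) (hf : ∀ z, G.indicator (fun _ => (1 : ℝ)) z ≤ f z)
    (c : ℝ) : P.real {ω | c • Z ω ∈ G} ≤ ∫ ω, f (c • Z ω) ∂P := by
  have hm : MeasurableSet {ω | c • Z ω ∈ G} := (hZ.const_smul c) hG
  rw [← integral_indicator_one hm]
  exact integral_mono ((integrable_const (1 : ℝ)).indicator hm)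
    (integrable_boundedContinuous_smul hZ f c) fun ω => hf (c • Z ω)

/-- Were this mass zero, a test function supported in `1 ≤ radius` and at least `1` on `2 < radius`
would have vanishing scaled expectation, against the Pareto lower bound. Without positive mass
`angularMeasure` would be the zero measure, with left endpoint `1` and right endpoint `0`. -/
lemma IsMRV.measure_one_lt_radius_ne_zero {Z : Ω → ℝ × ℝ} (h : IsMRV P Z α Λ)
    (hZ : Measurable Z) (hα : 0 < α) {c : ℝ} (hc : 0 < c)
    (htail : ∀ᶠ x : ℝ in atTop, c ≤ x ^ α * P.real {ω | x < radius (Z ω)}) :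
    Λ {z | 1 < radius z} ≠ 0 := by
  intro h0
  obtain ⟨f, hf⟩ : ∃ f : (ℝ × ℝ) →ᵇ ℝ, ∀ z, f z = max 0 (min 1 (radius z - 1)) :=
    ⟨BoundedContinuousFunction.ofNormedAddCommGroup
    (fun z => max 0 (min 1 (radius z - 1)))
    (continuous_const.max (continuous_const.min (continuous_radius.sub continuous_const))) 1
    (fun z => by rw [Real.norm_of_nonneg (le_max_left _ _)]; simp),
    fun _ => rfl⟩
  have hsupp : ∀ z, f z ≠ 0 → 1 < radius z := by
    intro z hz
    by_contra! hle
    exact hz (by rw [hf]; exact max_eq_left ((min_le_right _ _).trans (by linarith)))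
  have hint : ∫ z, f z ∂Λ = 0 := by
    refine integral_eq_zero_of_ae ?_
    refine measure_mono_null (fun z hz => ?_) h0
    exact hsupp z hz
  have hlim := h.vague f (zero_notMem_closure fun z hz => (hsupp z hz).le)
  rw [hint] at hlim
  have hthr : Tendsto (fun t : ℝ => 2 * t ^ (1 / α)) atTop atTop :=
    (tendsto_rpow_atTop (by positivity)).const_mul_atTop two_pos
  have hge : ∀ᶠ t : ℝ in atTop, c / 2 ^ α ≤ t * ∫ ω, f (t ^ (-(1 / α)) • Z ω) ∂P := by
    filter_upwards [hthr.eventually htail, eventually_gt_atTop 0] with t ht ht0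
    rw [Real.mul_rpow two_pos.le (by positivity), ← Real.rpow_mul ht0.le,
      one_div_mul_cancel hα.ne', Real.rpow_one] at ht
    rw [div_le_iff₀ (by positivity)]
    have hset : {ω | 2 * t ^ (1 / α) < radius (Z ω)} =
        {ω | t ^ (-(1 / α)) • Z ω ∈ {z | 2 < radius z}} := by
      ext ω
      simp only [Set.mem_ofPred_eq]
      rw [radius_smul, Real.rpow_neg ht0.le, lt_inv_mul_iff₀ (by positivity), mul_comm]
    have hle : P.real {ω | 2 * t ^ (1 / α) < radius (Z ω)} ≤
        ∫ ω, f (t ^ (-(1 / α)) • Z ω) ∂P := by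
      rw [hset]
      refine measureReal_le_integral_smul hZ
        (measurableSet_lt measurable_const continuous_radius.measurable) (fun z => ?_) _
      refine Set.indicator_le' (fun z hz => ?_) (fun z _ => ?_) z
      · have hz' : 2 < radius z := hz
        rw [hf]
        exact le_max_of_le_right (le_min le_rfl (by linarith))
      · rw [hf]; exact le_max_left _ _
    calc c ≤ 2 ^ α * t * P.real {ω | 2 * t ^ (1 / α) < radius (Z ω)} := ht
      _ ≤ 2 ^ α * t * ∫ ω, f (t ^ (-(1 / α)) • Z ω) ∂P := by gcongr
      _ = _ := by ring
  have := ge_of_tendsto hlim hge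
  exact absurd this (not_le.2 (by positivity))

lemma angularMeasure_apply_eq_zero_iff (hfin : Λ {z | 1 < radius z} ≠ ⊤) {B : Set ℝ}
    (hB : MeasurableSet B) :
    angularMeasure Λ B = 0 ↔ Λ ({z | 1 < radius z} ∩ angle ⁻¹' B) = 0 := by
  rw [angularMeasure, Measure.map_apply measurable_angle hB,
    cond_apply measurableSet_one_lt_radius, mul_eq_zero, ENNReal.inv_eq_zero]
  simp [hfin]

variable {S : Measure ℝ}

lemma leftEnd_nonneg : 0 ≤ leftEnd S :=
  le_csSup ⟨1, fun _ hw => hw.1.2⟩ ⟨by simp, by simp⟩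

lemma rightEnd_le_one : rightEnd S ≤ 1 :=
  csInf_le ⟨0, fun _ hw => hw.1.1⟩ ⟨by simp, by simp⟩

lemma measure_Ico_ne_zero_of_leftEnd_lt {w : ℝ} (hw : leftEnd S < w) (hw1 : w ≤ 1) :
    S (Set.Ico 0 w) ≠ 0 := fun h =>
  notMem_of_csSup_lt hw ⟨1, fun _ hw => hw.1.2⟩ ⟨⟨leftEnd_nonneg.trans hw.le, hw1⟩, h⟩

lemma measure_Ioc_ne_zero_of_lt_rightEnd {w : ℝ} (hw : w < rightEnd S) (hw0 : 0 ≤ w) :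
    S (Set.Ioc w 1) ≠ 0 := fun h =>
  notMem_of_lt_csInf hw ⟨0, fun _ hw => hw.1.1⟩ ⟨⟨hw0, hw.le.trans rightEnd_le_one⟩, h⟩

/-- If `v < w` with `[0,w)` and `(v,1]` both null, these two sets would cover `[0,1]`. -/
lemma leftEnd_le_rightEnd (hS : S (Set.Icc 0 1) ≠ 0) : leftEnd S ≤ rightEnd S := by
  refine csSup_le ⟨0, by simp, by simp⟩ fun w hw => ?_
  refine le_csInf ⟨1, by simp, by simp⟩ fun v hv => ?_
  by_contra! hlt
  refine hS (measure_mono_null (fun u hu => ?_) (measure_union_null hw.2 hv.2))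
  rcases lt_or_ge u w with h | h
  · exact Or.inl ⟨hu.1, h⟩
  · exact Or.inr ⟨hlt.trans_le h, hu.2⟩

lemma angularMeasure_Icc_ne_zero (hE : Λ E2ᶜ = 0) (hfin : Λ {z | 1 < radius z} ≠ ⊤)
    (hpos : Λ {z | 1 < radius z} ≠ 0) : angularMeasure Λ (Set.Icc 0 1) ≠ 0 := by
  rw [Ne, angularMeasure_apply_eq_zero_iff hfin measurableSet_Icc]
  intro h
  refine hpos (measure_mono_null (fun z hz => ?_) (measure_union_null h hE))
  by_cases hzE : z ∈ E2
  · exact Or.inl ⟨hz, angle_mem_Icc hzE⟩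
  · exact Or.inr hzE

/-- The part of the annulus `1 < x₁ + x₂ < M` with angle in `U`. -/
def sector (U : Set ℝ) (M : ℝ) : Set (ℝ × ℝ) := {z | 1 < radius z ∧ radius z < M ∧ angle z ∈ U}

lemma isOpen_sector {U : Set ℝ} (hU : IsOpen U) (M : ℝ) : IsOpen (sector U M) := by
  have h1 : IsOpen {z : ℝ × ℝ | 1 < radius z} := isOpen_lt continuous_const continuous_radius
  have h2 : IsOpen {z : ℝ × ℝ | radius z < M} := isOpen_lt continuous_radius continuous_const
  have hc : ContinuousOn angle {z : ℝ × ℝ | 1 < radius z} :=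
    continuous_fst.continuousOn.div continuous_radius.continuousOn
      fun z hz => (zero_lt_one.trans hz).ne'
  have h3 := (hc.isOpen_inter_preimage h1 hU).inter h2
  convert h3 using 1
  ext z
  simp only [sector, Set.mem_ofPred_eq, Set.mem_inter_iff, Set.mem_preimage]
  tauto

/-- The open-set half of the portmanteau theorem, for one set. Truncating at a large `M` preserves
positive mass and keeps radii bounded, so that `L` can later be bounded below on a compact interval.
-/
lemma IsMRV.exists_sector_lower_bound {Z : Ω → ℝ × ℝ} (h : IsMRV P Z α Λ) (hZ : Measurable Z)
    {U : Set ℝ} (hU : IsOpen U) (hΛ : Λ ({z | 1 < radius z} ∩ angle ⁻¹' U) ≠ 0) :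
    ∃ M > 0, ∃ c > 0, ∀ᶠ t : ℝ in atTop, c ≤ t * P.real {ω | t ^ (-(1 / α)) • Z ω ∈ sector U M} := by
  obtain ⟨M, hM⟩ : ∃ M : ℕ,
      Λ (sector U M) ≠ 0 := by
    by_contra! hall
    refine hΛ (measure_mono_null (fun z hz => ?_) (measure_iUnion_null hall))
    obtain ⟨M, hM⟩ := exists_nat_gt (radius z)
    exact Set.mem_iUnion.2 ⟨M, hz.1, hM, hz.2⟩
  set G := sector U M
  have hGo : IsOpen G := isOpen_sector hU M
  have hG0 : (0 : ℝ × ℝ) ∉ closure G := zero_notMem_closure fun z hz => hz.1.le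
  -- `Metric.infDist` to the empty set is `0`, so nonemptiness is needed for the test function to be
  -- positive on `G`.
  have hne : (Gᶜ).Nonempty := ⟨0, fun h0 => hG0 (subset_closure h0)⟩
  have hM0 : 0 < (M : ℝ) := by
    obtain ⟨z, hz⟩ := nonempty_of_measure_ne_zero hM
    linarith [hz.1, hz.2.1]
  obtain ⟨f, hf⟩ : ∃ f : (ℝ × ℝ) →ᵇ ℝ, ∀ z, f z = min 1 (Metric.infDist z Gᶜ) :=
    ⟨BoundedContinuousFunction.ofNormedAddCommGroup
    (fun z => min 1 (Metric.infDist z Gᶜ))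
    (continuous_const.min (Metric.continuous_infDist_pt _)) 1
    (fun z => by
      rw [Real.norm_of_nonneg (le_min zero_le_one Metric.infDist_nonneg)]
      exact min_le_left _ _),
    fun _ => rfl⟩
  have hf0 : ∀ z, 0 ≤ f z := fun z => (hf z).symm ▸ le_min zero_le_one Metric.infDist_nonneg
  have hf1 : ∀ z, f z ≤ G.indicator (fun _ => (1 : ℝ)) z := by
    intro z
    by_cases hz : z ∈ G
    · rw [Set.indicator_of_mem hz, hf]; exact min_le_left _ _
    · rw [Set.indicator_of_notMem hz, hf, Metric.infDist_zero_of_mem (by exact hz)]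
      exact min_le_right _ _
  have hsupp : Function.support f = G := by
    ext z
    constructor
    · intro hz
      by_contra hzG
      exact hz (le_antisymm ((hf1 z).trans (by simp [hzG])) (hf0 z))
    · intro hz
      rw [Function.mem_support, hf]
      refine ne_of_gt (lt_min zero_lt_one ?_)
      exact (hGo.isClosed_compl.notMem_iff_infDist_pos hne).1 (by simpa using hz)
  have hΛG : Λ G ≠ ⊤ := (h.finite_away G hGo.measurableSet hG0).ne
  have hfi : Integrable f Λ := by
    refine Integrable.mono' ((integrable_indicator_iff hGo.measurableSet).2
      (integrableOn_const hΛG (C := (1 : ℝ)))) f.continuous.measurable.aestronglyMeasurable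
      (Eventually.of_forall fun z => ?_)
    rw [Real.norm_of_nonneg (hf0 z)]
    exact hf1 z
  have hpos : 0 < ∫ z, f z ∂Λ := by
    rw [integral_pos_iff_support_of_nonneg hf0 hfi, hsupp]
    exact pos_iff_ne_zero.2 hM
  have hlim := h.vague f (by rw [tsupport, hsupp]; exact hG0)
  refine ⟨M, hM0, _, half_pos hpos, ?_⟩
  filter_upwards [hlim.eventually_const_lt (half_lt_self hpos), eventually_gt_atTop 0]
    with t ht ht0
  exact ht.le.trans (mul_le_mul_of_nonneg_left
    (integral_smul_le_measureReal hZ hGo.measurableSet hf1 _) ht0.le)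

variable {X : ℕ → Ω → ℝ × ℝ} {k : ℕ → ℕ} {Y : (n : ℕ) → Ω → Fin n → ℝ × ℝ}
  {d : ℝ → ℝ × ℝ → ℝ} {L : ℝ → ℝ} {p : ℝ × ℝ}

/-- The sector is scaled by the upper threshold, so its points exceed `R_(k)`, and their number is
of order at least `k`. The open `U` admits a test function; the closed `V` makes `[0,1] ∩ V`
compact, so `d` has a positive lower bound there. -/
lemma withHighProb_le_tailDist (hX_meas : ∀ i, Measurable (X i)) (hX_indep : iIndepFun X P)
    (hX_ident : ∀ i, IdentDistrib (X i) (X 0) P P) (hX_E2 : ∀ i ω, X i ω ∈ E2)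
    (hMRV : IsMRV P (X 0) α Λ) (hd : IsAngularDist d) (hp : p ∈ Delta)
    (hL_cont : ContinuousOn L (Set.Ici 1)) (hL_pos : ∀ r, 1 ≤ r → 0 < L r)
    (hk : Tendsto k atTop atTop) (hm : Tendsto (fun n : ℕ => (n : ℝ) / k n) atTop atTop)
    (hY : ∀ n ω, IsRadialOrdering (fun i : Fin n => X i ω) (Y n ω))
    {A A' : ℝ} (hA : 0 < A) (hA' : 0 < A') {U V : Set ℝ} (hU : IsOpen U) (hV : IsClosed V)
    (hUV : U ⊆ V) (hVp : Disjoint V (Set.Icc p.1 p.2))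
    (hΛ : Λ ({z | 1 < radius z} ∩ angle ⁻¹' U) ≠ 0) :
    ∃ c > 0, WithHighProb P (fun n ω => ∀ (h1 : 1 ≤ k n) (h2 : k n ≤ n),
      threshold α A (n / k n) ≤ radius (Y n ω ⟨k n - 1, by omega⟩) →
      radius (Y n ω ⟨k n - 1, by omega⟩) ≤ threshold α A' (n / k n) →
      c ≤ tailDist d L h1 h2 (Y n ω) p) := by
  obtain ⟨M, hM0, c₃, hc₃, hev⟩ := hMRV.exists_sector_lower_bound (hX_meas 0) hU hΛ
  obtain ⟨c₁, hc₁, hdc₁⟩ := (isCompact_Icc.inter_right hV).exists_forall_le'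
    ((hd.continuousOn_left p hp).mono Set.inter_subset_left) (a := 0)
    fun w hw => (hd.pos_iff w hw.1 p hp).2 (Set.disjoint_left.1 hVp hw.2)
  -- `M` times the upper threshold equals `M'` times the lower one.
  set M' := M * (A' / A) ^ (1 / α) with hM'
  obtain ⟨c₂, hc₂, hLc₂⟩ := (isCompact_Icc (a := (1 : ℝ)) (b := M')).exists_forall_le'
    (hL_cont.mono Set.Icc_subset_Ici_self) (a := 0) fun r hr => hL_pos r hr.1
  -- The expected count is at least `c₃ k / A'`, more than twice the count `c₃ k / (4 A')` required.
  refine ⟨c₁ * c₂ * (c₃ / (4 * A')), by positivity, ?_⟩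
  have hτ : Tendsto (fun n : ℕ => A' * ((n : ℝ) / k n)) atTop atTop := hm.const_mul_atTop hA'
  have hGm : MeasurableSet (sector U M) :=
    (isOpen_sector hU M).measurableSet
  set 𝒜 : ℕ → Set (ℝ × ℝ) := fun n => {z | (A' * ((n : ℝ) / k n)) ^ (-(1 / α)) • z ∈
    sector U M} with h𝒜
  refine (withHighProb_le_count hX_meas hX_indep hX_ident
    ((tendsto_natCast_atTop_atTop.comp hk).const_mul_atTop
      (by positivity : 0 < c₃ / (4 * A'))) (A := 𝒜)
    (fun n => (measurable_const_smul ((A' * ((n : ℝ) / k n)) ^ (-(1 / α)))) hGm) ?_).mono ?_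
  · filter_upwards [hτ.eventually hev, hm.eventually_gt_atTop 0] with n hn hmn
    obtain ⟨hn0, hk0⟩ := pos_of_div_pos hmn
    change c₃ ≤ A' * (n / k n) * P.real (X 0 ⁻¹' 𝒜 n) at hn
    simp only [Function.comp_apply]
    have e : A' * (n / k n) * P.real (X 0 ⁻¹' 𝒜 n) =
      (n * P.real (X 0 ⁻¹' 𝒜 n)) * (A' / k n) := by field_simp
    rw [e, ← div_le_iff₀ (by positivity)] at hn
    have e' : 2 * (c₃ / (4 * A') * k n) = c₃ / (A' / k n) / 2 := by field_simp; norm_num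
    have : 0 ≤ c₃ / (A' / k n) := by positivity
    linarith
  · filter_upwards [hm.eventually_gt_atTop 0] with n hmn ω h h1 h2 ht hT
    obtain ⟨hn0, hk0⟩ := pos_of_div_pos hmn
    refine le_trans ?_ (le_tailDist (hY n ω) (fun i => hX_E2 i ω) h1 h2 hd hp hL_pos
      (A := 𝒜 n) (c₁ := c₁) (T := threshold α A' (n / k n)) hc₂.le (fun z hz hzA => ?_) (fun z hz => ?_) hLc₂
      (by positivity) ht hT)
    · rw [← count_eq_sum_fin]
      refine mul_le_mul_of_nonneg_left ?_ (by positivity)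
      rw [one_div, le_inv_mul_iff₀ hk0, mul_comm]
      exact h
    · refine hdc₁ _ ⟨angle_mem_Icc hz, hUV ?_⟩
      have := hzA.2.2
      rwa [angle_smul (by positivity)] at this
    · have h3 := hz.1
      have h4 := hz.2.1
      rw [radius_smul, Real.rpow_neg (by positivity)] at h3 h4
      have hTpos : 0 < (A' * ((n : ℝ) / k n)) ^ (1 / α) := by positivity
      rw [inv_mul_lt_iff₀ hTpos] at h4
      rw [lt_inv_mul_iff₀ hTpos, mul_one] at h3
      refine ⟨h3, h4.le.trans (le_of_eq ?_)⟩
      rw [hM', threshold, mul_comm _ M, mul_assoc, ← Real.mul_rpow (by positivity) (by positivity)]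
      congr 2
      field_simp

end Exponent

/-! ### Consistency -/

section Consistency

variable {Ω : Type*} [MeasurableSpace Ω] {P : Measure Ω} {X : ℕ → Ω → ℝ × ℝ} {k : ℕ → ℕ}
  {Y : (n : ℕ) → Ω → Fin n → ℝ × ℝ} {d : ℝ → ℝ × ℝ → ℝ} {L : ℝ → ℝ} {lam γ : ℝ}
  {ahat bhat : ℕ → Ω → ℝ}

/-- An interval on which the averaged distance stays bounded away from zero does not contain the
estimated support. -/
lemma withHighProb_not_subset (hX_E2 : ∀ i ω, X i ω ∈ E2) (hd : IsAngularDist d)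
    (hL_pos : ∀ r, 1 ≤ r → 0 < L r) (hlam : 0 < lam) (hγ : 0 < γ)
    (hk : Tendsto k atTop atTop) (hkn : ∀ᶠ n in atTop, 1 ≤ k n ∧ k n ≤ n)
    (hY : ∀ n ω, IsRadialOrdering (fun i : Fin n => X i ω) (Y n ω))
    (hest : ∀ (n : ℕ) (h1 : 1 ≤ k n) (h2 : k n ≤ n),
      IsEstimator d L lam γ h1 h2 (Y n) (ahat n) (bhat n))
    {p : ℝ × ℝ} (hp : p ∈ Delta) {c : ℝ} (hc : 0 < c)
    (h : WithHighProb P (fun n ω => ∀ (h1 : 1 ≤ k n) (h2 : k n ≤ n),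
      c ≤ tailDist d L h1 h2 (Y n ω) p)) :
    WithHighProb P (fun n ω => ¬ (p.1 ≤ ahat n ω ∧ bhat n ω ≤ p.2)) := by
  have hbig : Tendsto (fun n => lam * c * (k n : ℝ) ^ γ) atTop atTop :=
    ((tendsto_rpow_atTop hγ).comp (tendsto_natCast_atTop_atTop.comp hk)).const_mul_atTop
      (mul_pos hlam hc)
  refine h.mono ?_
  filter_upwards [hkn, hbig.eventually_gt_atTop 1] with n ⟨h1, h2⟩ hn ω hω hcon
  have hE := hest n h1 h2
  have hx : ∀ i : Fin n, X i ω ∈ E2 := fun i => hX_E2 i ω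
  have h01 : ((0, 1) : ℝ × ℝ) ∈ Delta := by simp [Delta]
  -- The interval `[0,1]` has zero penalty and value `1`, while the penalty at the minimizer would
  -- be at least `lam * c * k ^ γ > 1`.
  have hmin : objective d L lam γ h1 h2 (Y n ω) (ahat n ω, bhat n ω)
      ≤ objective d L lam γ h1 h2 (Y n ω) (0, 1) := hE.isMinOn ω h01
  have hanti := tailDist_anti (hY n ω) hx h1 h2 hd hL_pos (hE.mem ω) hp hcon.1 hcon.2
  have hle := (hE.mem ω).2.2
  have hD := (hω h1 h2).trans hanti
  simp only [objective, tailDist_zero_one (hY n ω) hx h1 h2 hd] at hmin hle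
  have hcoef : 0 ≤ lam * (k n : ℝ) ^ γ := by positivity
  have := mul_le_mul_of_nonneg_left hD hcoef
  linarith

/-- The second expression is `(k / n ^ (ρ/(γ+ρ))) ^ (γ+ρ)`; the first limit holds because `ρ/(γ+ρ) ≤
1`. -/
lemma tendsto_div_of_isLittleO {ρ : ℝ} (hρ : 0 < ρ) (hγ : 0 < γ) (hk : Tendsto k atTop atTop)
    (hk_o : (fun n : ℕ => (k n : ℝ)) =o[atTop] (fun n : ℕ => (n : ℝ) ^ (ρ / (γ + ρ)))) :
    Tendsto (fun n : ℕ => (n : ℝ) / k n) atTop atTop ∧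
      Tendsto (fun n : ℕ => (k n : ℝ) ^ γ * ((n : ℝ) / k n) ^ (-ρ)) atTop (𝓝 0) := by
  have hlim := hk_o.tendsto_div_nhds_zero
  have hkpos : ∀ᶠ n : ℕ in atTop, 0 < (k n : ℝ) :=
    (tendsto_natCast_atTop_atTop.comp hk).eventually_gt_atTop 0
  constructor
  · have hinv : Tendsto (fun n : ℕ => (k n : ℝ) / n) atTop (𝓝[>] 0) := by
      refine tendsto_nhdsWithin_iff.2 ⟨?_, ?_⟩
      · refine tendsto_of_tendsto_of_tendsto_of_le_of_le' tendsto_const_nhds hlim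
          (Eventually.of_forall fun n => by positivity) ?_
        filter_upwards [eventually_ge_atTop 1] with n hn
        have hn1 : (1 : ℝ) ≤ n := by exact_mod_cast hn
        refine div_le_div_of_nonneg_left (by positivity) (by positivity) ?_
        calc (n : ℝ) ^ (ρ / (γ + ρ)) ≤ (n : ℝ) ^ (1 : ℝ) :=
              Real.rpow_le_rpow_of_exponent_le hn1 ((div_le_one (by positivity)).2 (by linarith))
          _ = n := Real.rpow_one _
      · filter_upwards [hkpos, eventually_gt_atTop 0] with n hn hn0
        have : (0 : ℝ) < n := by exact_mod_cast hn0
        exact Set.mem_Ioi.2 (by positivity)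
    refine hinv.inv_tendsto_nhdsGT_zero.congr fun n => ?_
    simp
  · have h1 := hlim.rpow_const (p := γ + ρ) (Or.inr (by positivity))
    rw [Real.zero_rpow (by positivity)] at h1
    refine h1.congr' ?_
    filter_upwards [hkpos, eventually_gt_atTop 0] with n hn hn0
    have hn0' : (0 : ℝ) < n := by exact_mod_cast hn0
    rw [Real.div_rpow hn.le (by positivity), ← Real.rpow_mul hn0'.le,
      div_mul_cancel₀ _ (by positivity), Real.rpow_neg (by positivity),
      Real.div_rpow hn0'.le hn.le, inv_div, Real.rpow_add hn]
    ring

end Consistency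

end AngularSupport

end

open AngularSupport in
theorem theoremG1 {Ω : Type*} [MeasurableSpace Ω] (P : Measure Ω) [IsProbabilityMeasure P]
    -- the i.i.d. observations
    (X : ℕ → Ω → ℝ × ℝ) (hX_meas : ∀ i, Measurable (X i)) (hX_indep : iIndepFun X P)
    (hX_ident : ∀ i, IdentDistrib (X i) (X 0) P P)
    (hX_E2 : ∀ i ω, X i ω ∈ AngularSupport.E2)
    -- tail behaviour of their common law
    (α : ℝ) (hα : 0 < α) (Λ : Measure (ℝ × ℝ))
    (hpareto : AngularSupport.ParetoMarginals P (X 0) α)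
    (hMRV : AngularSupport.IsMRV P (X 0) α Λ)
    -- the angular support interval and the second-order condition
    (a b : ℝ)
    (ha : a = AngularSupport.leftEnd (AngularSupport.angularMeasure Λ))
    (hb : b = AngularSupport.rightEnd (AngularSupport.angularMeasure Λ))
    (ρ : ℝ) (hρ : 0 < ρ) (hSO : AngularSupport.SecondOrder P (X 0) a b ρ)
    -- the distance, the weights and the tuning parameters
    (d : ℝ → ℝ × ℝ → ℝ) (hd : AngularSupport.IsAngularDist d)
    (L : ℝ → ℝ) (hL_cont : ContinuousOn L (Set.Ici 1)) (hL_pos : ∀ r, 1 ≤ r → 0 < L r)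
    (C δ : ℝ) (hC : 0 < C) (hδ : 0 < δ) (hδα : δ < α)
    (hL_le : ∀ r, 1 ≤ r → L r ≤ C * r ^ δ)
    (lam γ : ℝ) (hlam : 0 < lam) (hγ : 0 < γ)
    -- the extremal subsample sizes
    (k : ℕ → ℕ) (hk_top : Tendsto k atTop atTop)
    (hk_o : (fun n : ℕ => (k n : ℝ)) =o[atTop] (fun n : ℕ => (n : ℝ) ^ (ρ / (γ + ρ))))
    -- the radially ordered samples and the estimator
    (Y : (n : ℕ) → Ω → Fin n → ℝ × ℝ) (hY_meas : ∀ n, Measurable (Y n))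
    (hY : ∀ n ω, AngularSupport.IsRadialOrdering (fun i : Fin n => X i ω) (Y n ω))
    (ahat bhat : ℕ → Ω → ℝ)
    (hest : ∀ (n : ℕ) (h1 : 1 ≤ k n) (h2 : k n ≤ n),
      AngularSupport.IsEstimator d L lam γ h1 h2 (Y n) (ahat n) (bhat n)) :
    TendstoInMeasure P ahat atTop (fun _ => a) ∧
      TendstoInMeasure P bhat atTop (fun _ => b) := by
  obtain ⟨hm, hkm⟩ := tendsto_div_of_isLittleO hρ hγ hk_top hk_o
  have hkn : ∀ᶠ n in atTop, 1 ≤ k n ∧ k n ≤ n := by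
    filter_upwards [hk_top.eventually_ge_atTop 1, hm.eventually_ge_atTop 1] with n h1 h2
    refine ⟨h1, ?_⟩
    have hk0 : (0 : ℝ) < k n := by exact_mod_cast h1
    rw [one_le_div hk0] at h2
    exact_mod_cast h2
  obtain ⟨c, hc, c', hc', htail⟩ := exists_tail_bounds (hX_E2 0) hpareto
  have htl := htail.mono fun _ h => h.1
  have htu := htail.mono fun _ h => h.2
  have hfin := hMRV.measure_one_lt_radius_ne_top
  have hpos := hMRV.measure_one_lt_radius_ne_zero (hX_meas 0) hα hc htl
  have hlow := withHighProb_threshold_le hX_meas hX_indep hX_ident hα hc htl hk_top hm hY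
  have hupp := withHighProb_le_threshold hX_meas hX_indep hX_ident hα hc' htu hk_top hm hY
  have hab : a ≤ b := by
    rw [ha, hb]
    exact leftEnd_le_rightEnd (angularMeasure_Icc_ne_zero hMRV.concentrated hfin hpos)
  have ha0 : 0 ≤ a := ha ▸ leftEnd_nonneg
  have hb1 : b ≤ 1 := hb ▸ rightEnd_le_one
  have hexcl : ∀ p ∈ Delta, ∀ U V : Set ℝ, IsOpen U → IsClosed V → U ⊆ V →
      Disjoint V (Set.Icc p.1 p.2) → Λ ({z | 1 < radius z} ∩ angle ⁻¹' U) ≠ 0 →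
      WithHighProb P (fun n ω => ¬ (p.1 ≤ ahat n ω ∧ bhat n ω ≤ p.2)) := by
    intro p hp U V hU hV hUV hVp hΛU
    obtain ⟨c₀, hc₀, hwhp⟩ := withHighProb_le_tailDist hX_meas hX_indep hX_ident hX_E2 hMRV hd
      hp hL_cont hL_pos hk_top hm hY (half_pos hc) (by positivity : 0 < 2 * c') hU hV hUV hVp hΛU
    refine withHighProb_not_subset hX_E2 hd hL_pos hlam hγ hk_top hkn hY hest hp hc₀
      (((hwhp.and hlow).and hupp).mono (Eventually.of_forall fun n ω h h1 h2 => ?_))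
    exact h.1.1 h1 h2 (h.1.2 h1 h2) (h.2 h1 h2)
  have hleft : ∀ s, a < s → WithHighProb P (fun n ω => ahat n ω ≤ s) := by
    intro s hs
    rcases lt_or_ge 1 s with h1s | hs1
    · refine WithHighProb.of_forall ?_
      filter_upwards [hkn] with n hn ω
      exact (((hest n hn.1 hn.2).mem ω).1.2).trans h1s.le
    -- `a < w` puts angular mass in `[0,w)`, and the gap `w < s` separates the closed half-line from
    -- `[s,1]`.
    · obtain ⟨w, haw, hws⟩ := exists_between hs
      refine (hexcl (s, 1) ⟨⟨ha0.trans hs.le, hs1⟩, by simp, hs1⟩ (Set.Iio w) (Set.Iic w) isOpen_Iio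
        isClosed_Iic Set.Iio_subset_Iic_self ?_ ?_).mono ?_
      · exact Set.disjoint_left.2 fun u hu hu' => absurd (hu'.1.trans hu) (not_le.2 hws)
      · have := measure_Ico_ne_zero_of_leftEnd_lt (ha ▸ haw) (hws.le.trans hs1)
        rw [Ne, angularMeasure_apply_eq_zero_iff hfin measurableSet_Ico] at this
        exact fun h0 => this (measure_mono_null
          (Set.inter_subset_inter_right _ (Set.preimage_mono Set.Ico_subset_Iio_self)) h0)
      · filter_upwards [hkn] with n hn ω h
        by_contra! hlt
        exact h ⟨hlt.le, ((hest n hn.1 hn.2).mem ω).2.1.2⟩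
  have hright : ∀ s, s < b → WithHighProb P (fun n ω => s ≤ bhat n ω) := by
    intro s hs
    rcases lt_or_ge s 0 with h0s | hs0
    · refine WithHighProb.of_forall ?_
      filter_upwards [hkn] with n hn ω
      exact h0s.le.trans (((hest n hn.1 hn.2).mem ω).2.1.1)
    · obtain ⟨w, hsw, hwb⟩ := exists_between hs
      refine (hexcl (0, s) ⟨by simp, ⟨hs0, hs.le.trans hb1⟩, hs0⟩ (Set.Ioi w) (Set.Ici w) isOpen_Ioi
        isClosed_Ici Set.Ioi_subset_Ici_self ?_ ?_).mono ?_
      · exact Set.disjoint_left.2 fun u hu hu' => absurd (le_trans hu hu'.2) (not_le.2 hsw)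
      · have := measure_Ioc_ne_zero_of_lt_rightEnd (hb ▸ hwb) (hs0.trans hsw.le)
        rw [Ne, angularMeasure_apply_eq_zero_iff hfin measurableSet_Ioc] at this
        exact fun h0 => this (measure_mono_null
          (Set.inter_subset_inter_right _ (Set.preimage_mono Set.Ioc_subset_Ioi_self)) h0)
      · filter_upwards [hkn] with n hn ω h
        by_contra! hlt
        exact h ⟨((hest n hn.1 hn.2).mem ω).1.1, hlt.le⟩
  have hboth : ∀ ε, 0 < ε → WithHighProb P (fun n ω => |ahat n ω - a| < ε ∧ |bhat n ω - b| < ε) := by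
    intro ε hε
    -- The length comparison costs `3η` (`2η` from enlarging, `η` from the penalty) and the opposite
    -- endpoint another `η`; the total `4η` is below `ε`.
    set η := ε / 5 with hη
    have hη0 : 0 < η := by positivity
    set p : ℝ × ℝ := (max (a - η) 0, min (b + η) 1) with hp_def
    have hp : p ∈ Delta := by
      refine ⟨⟨le_max_right _ _, max_le (by linarith) zero_le_one⟩,
        ⟨le_min (by linarith) zero_le_one, min_le_right _ _⟩,
        max_le (le_min (by linarith) (by linarith)) (le_min (by linarith) zero_le_one)⟩
    have hB := hSO (Set.Icc 0 1 \ Set.Icc p.1 p.2) (measurableSet_Icc.diff measurableSet_Icc)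
      (Set.sdiff_subset_sdiff_right (Set.Icc_subset_Icc
        (max_le (by linarith) ha0) (le_min (by linarith) hb1))) (by
        -- Clipping `p` to `[0,1]` removes no angle, so the excluded angles remain at distance at
        -- least `η` from `[a,b]`.
        have hsub : closure (Set.Icc 0 1 \ Set.Icc p.1 p.2) ⊆ Set.Iic (a - η) ∪ Set.Ici (b + η) := by
          refine closure_minimal (fun w hw => ?_) (isClosed_Iic.union isClosed_Ici)
          by_contra! hcon
          simp only [Set.mem_union, Set.mem_Iic, Set.mem_Ici, not_or, not_le] at hcon
          exact hw.2 ⟨max_le hcon.1.le hw.1.1, le_min hcon.2.le hw.1.2⟩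
        refine Set.eq_empty_iff_forall_notMem.2 fun w hw => ?_
        rcases hsub hw.1 with h | h
        · have := hw.2.1
          simp only [Set.mem_Iic] at h
          linarith
        · have := hw.2.2
          simp only [Set.mem_Ici] at h
          linarith)
    have hD := withHighProb_tailDist_le hX_meas hX_ident hX_E2 hα hρ hc' htu hB hd hp hL_pos hC hδ
      hδα hL_le hlam hm hkm hY (half_pos hc) hη0
    refine ((((hleft (a + η) (by linarith)).and (hright (b - η) (by linarith))).and
      hlow).and hD).mono ?_
    filter_upwards [hkn] with n ⟨h1, h2⟩ ω ⟨⟨⟨hl, hr⟩, hthr⟩, hDn⟩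
    have hE := hest n h1 h2
    have hmin : objective d L lam γ h1 h2 (Y n ω) (ahat n ω, bhat n ω)
      ≤ objective d L lam γ h1 h2 (Y n ω) p := hE.isMinOn ω hp
    have hnn := tailDist_nonneg (hY n ω) (fun i => hX_E2 i ω) h1 h2 hd hL_pos (hE.mem ω)
    have hDn' := hDn h1 h2 (hthr h1 h2)
    have hp1 : a - η ≤ p.1 := le_max_left _ _
    have hp2 : p.2 ≤ b + η := min_le_left _ _
    have hcoef : 0 ≤ lam * (k n : ℝ) ^ γ := by positivity
    have hnn' := mul_nonneg hcoef hnn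
    simp only [objective] at hmin
    rw [abs_lt, abs_lt]
    refine ⟨⟨?_, ?_⟩, ?_, ?_⟩ <;> linarith
  simp only [tendstoInMeasure_iff_norm, Real.norm_eq_abs]
  constructor
  · intro ε hε
    refine ((hboth ε hε).mono (Q' := fun n ω => ¬ ε ≤ |ahat n ω - a|)
      (Eventually.of_forall fun n ω h => not_le.2 h.1)).congr fun n => ?_
    simp
  · intro ε hε
    refine ((hboth ε hε).mono (Q' := fun n ω => ¬ ε ≤ |bhat n ω - b|)
      (Eventually.of_forall fun n ω h => not_le.2 h.2)).congr fun n => ?_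
    simp
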